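/- Let $W_0,W_1$ be commuting isometries on a complex Hilbert space $\mathfrak K$; the pair $\mathbb W=(W_0,W_1)$ is called a *bi-isometry*. A closed subspace $\mathfrak M\subset\mathfrak K$ is *reducing* for $\mathbb W$ if $\mathfrak M$ and $\mathfrak M^\perp$ are invariant for $W_0$ and $W_1$, and $\mathbb W$ is *$\{0\}$-pure* if it has no nonzero reducing subspace $\mathfrak M$ for which $W_0|\mathfrak M$ is unitary. Let $\mathfrak H=\bigoplus_{k\ge0}W_0^k(\mathfrak K\ominus W_0\mathfrak K)$ be the space of the shift part of the von Neumann–Wold decomposition of $W_0$, and put $V_0=W_0|\mathfrak H$, $A=P_{\mathfrak H}W_1|\mathfrak H$ and $\mathfrak E=\mathfrak H\ominus V_0\mathfrak H$. The *characteristic function* of $\mathbb W$ is the $\mathcal L(\mathfrak E)$-valued function $$\Theta_{\mathbb W}(z)=P_{\mathfrak E}(I-zV_0^*)^{-1}A|\mathfrak E,\qquad z\in\mathbb D=\{z\in\mathbb C:|z|<1\}.$$ Two bi-isometries $\mathbb W,\mathbb W'$ are *unitarily equivalent* if there is a unitary operator $U$ with $UW_i=W_i'U$ for $i=0,1$. Two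 functions $\Theta:\mathbb D\to\mathcal L(\mathfrak E)$ and $\Theta':\mathbb D\to\mathcal L(\mathfrak E')$ are *unitarily equivalent* if there is a unitary operator $U:\mathfrak E\to\mathfrak E'$ with $U\Theta(z)=\Theta'(z)U$ for all $z\in\mathbb D$. Let $\mathbb W$ and $\mathbb W'$ be bi-isometries on complex Hilbert spaces $\mathfrak K$ and $\mathfrak K'$, with characteristic functions $\Theta:\mathbb D\to\mathcal L(\mathfrak E)$ and $\Theta':\mathbb D\to\mathcal L(\mathfrak E')$. 1. The characteristic function of $\mathbb W\oplus\mathbb W'=(W_0\oplus W_0',W_1\oplus W_1')$ is $z\mapsto\Theta(z)\oplus\Theta'(z)$, $z\in\mathbb D$, where the space on which it acts is identified with $\mathfrak E\oplus\mathfrak E'$ as a subspace of $\mathfrak K\oplus\mathfrak K'$. 2. If $\mathbb W$ is unitarily equivalent to $\mathbb W'$, then $\Theta$ is unitarily equivalent to $\Theta'$. 3. If $\mathbb W$ and $\mathbb W'$ are $\{0\}$-pure and $\Theta$ is unitarily equivalent to $\Theta'$, then $\mathbb W$ is unitarily equivalent to $\mathbb W'$. 4. For every complex Hilbert space $\mathfrak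 F$ and every analytic function $\Theta:\mathbb D\to\mathcal L(\mathfrak F)$ with $\|\Theta(z)\|\le1$ for all $z\in\mathbb D$, there is a $\{0\}$-pure bi-isometry whose characteristic function is unitarily equivalent to $\Theta$. -/

import Mathlib

universe u v w

noncomputable section

/-- A bi-isometry: an ordered pair of commuting isometries on a Hilbert space. -/
structure BiIsometry (K : Type u) [NormedAddCommGroup K] [InnerProductSpace ℂ K] where
  /-- the first isometry -/
  W₀ : K →ₗᵢ[ℂ] K
  /-- the second isometry -/
  W₁ : K →ₗᵢ[ℂ] K
  comm : ∀ x, W₀ (W₁ x) = W₁ (W₀ x)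

/-- The orthogonal direct sum `T ⊕ T'` of two isometries, on the Hilbert space direct sum. -/
def isometryDirectSum {K : Type u} {K' : Type v}
    [NormedAddCommGroup K] [InnerProductSpace ℂ K]
    [NormedAddCommGroup K'] [InnerProductSpace ℂ K']
    (T : K →ₗᵢ[ℂ] K) (T' : K' →ₗᵢ[ℂ] K') :
    WithLp 2 (K × K') →ₗᵢ[ℂ] WithLp 2 (K × K') where
  toFun x := WithLp.toLp 2 (T x.fst, T' x.snd)
  map_add' x y := by apply (WithLp.equiv 2 _).injective; ext <;> simp
  map_smul' c x := by apply (WithLp.equiv 2 _).injective; ext <;> simp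
  norm_map' x := by simp [WithLp.prod_norm_eq_of_L2]

section FunctionOfPair

variable {H : Type u} [NormedAddCommGroup H] [InnerProductSpace ℂ H]

/-- The subspace `𝔈 = ℌ ⊖ V ℌ` (which equals `ker V*`). -/
def defectSpace (V : H →L[ℂ] H) : Submodule ℂ H :=
  (LinearMap.range (V : H →ₗ[ℂ] H))ᗮ

variable [CompleteSpace H]

/-- The operator function of a pair `(V, A)`: the operator `P_𝔈 (I - z V*)⁻¹ A | 𝔈` on
`𝔈 = ℌ ⊖ V ℌ`. For `‖V‖ ≤ 1` and `‖z‖ < 1` the operator `I - z V*` is invertible, so that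
`Ring.inverse` is its inverse. Only the values with `‖z‖ < 1` are ever used. -/
def pairFunction (V A : H →L[ℂ] H) (z : ℂ) : defectSpace V →L[ℂ] defectSpace V :=
  haveI : CompleteSpace (defectSpace V) := Submodule.instOrthogonalCompleteSpace _
  (defectSpace V).orthogonalProjectionOnto ∘L Ring.inverse (1 - z • ContinuousLinearMap.adjoint V) ∘L A ∘L
    (defectSpace V).subtypeL

end FunctionOfPair

namespace BiIsometry

section Basic

variable {K : Type u} [NormedAddCommGroup K] [InnerProductSpace ℂ K]

/-- `M` is a reducing (closed) subspace for the pair: `M` and its orthogonal complement are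
invariant for both isometries. -/
structure IsReducing (W : BiIsometry K) (M : Submodule ℂ K) : Prop where
  isClosed : IsClosed (M : Set K)
  inv₀ : ∀ x ∈ M, W.W₀ x ∈ M
  inv₁ : ∀ x ∈ M, W.W₁ x ∈ M
  orth_inv₀ : ∀ x ∈ Mᗮ, W.W₀ x ∈ Mᗮ
  orth_inv₁ : ∀ x ∈ Mᗮ, W.W₁ x ∈ Mᗮ

/-- `{0}`-purity: there is no nonzero reducing subspace `M` for which `W₀ | M` is unitary.
As `W₀ | M` is an isometry of `M` into `M`, it is unitary when it maps `M` onto `M`. -/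
def IsZeroPure (W : BiIsometry K) : Prop :=
  ∀ M : Submodule ℂ K, W.IsReducing M → (∀ y ∈ M, ∃ x ∈ M, W.W₀ x = y) → M = ⊥

/-- Unitary equivalence: one unitary operator conjugates both isometries. -/
def UnitarilyEquivalent {K' : Type v} [NormedAddCommGroup K'] [InnerProductSpace ℂ K']
    (W : BiIsometry K) (W' : BiIsometry K') : Prop :=
  ∃ U : K ≃ₗᵢ[ℂ] K', (∀ x, U (W.W₀ x) = W'.W₀ (U x)) ∧ ∀ x, U (W.W₁ x) = W'.W₁ (U x)

/-- The direct sum `(W₀ ⊕ W₀', W₁ ⊕ W₁')`. -/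
def directSum {K' : Type v} [NormedAddCommGroup K'] [InnerProductSpace ℂ K']
    (W : BiIsometry K) (W' : BiIsometry K') : BiIsometry (WithLp 2 (K × K')) where
  W₀ := isometryDirectSum W.W₀ W'.W₀
  W₁ := isometryDirectSum W.W₁ W'.W₁
  comm x := by
    apply (WithLp.equiv 2 _).injective
    ext <;> simp [isometryDirectSum, W.comm, W'.comm]

/-- The space of the shift part in the von Neumann-Wold decomposition of `W₀`: the closed
linear span of the subspaces `W₀ᵏ (𝔎 ⊖ W₀ 𝔎)`, `k ≥ 0`. -/
def shiftSpace (W : BiIsometry K) : Submodule ℂ K :=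
  (⨆ k : ℕ, (defectSpace W.W₀.toContinuousLinearMap).map (W.W₀.toLinearMap ^ k)).topologicalClosure

theorem map_mem_shiftSpace (W : BiIsometry K) (x : K) (hx : x ∈ W.shiftSpace) :
    W.W₀ x ∈ W.shiftSpace := by
  have h : (⨆ k : ℕ, (defectSpace W.W₀.toContinuousLinearMap).map
      (W.W₀.toLinearMap ^ k)) ≤ W.shiftSpace.comap W.W₀.toLinearMap := by
    refine iSup_le fun k => ?_
    rintro _ ⟨y, hy, rfl⟩
    refine Submodule.le_topologicalClosure _ (Submodule.mem_iSup_of_mem (k + 1) ⟨y, hy, ?_⟩)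
    rw [pow_succ']
    rfl
  have hcl : IsClosed (W.shiftSpace.comap W.W₀.toLinearMap : Set K) :=
    (Submodule.isClosed_topologicalClosure _).preimage W.W₀.continuous
  exact Submodule.topologicalClosure_minimal _ h hcl hx

/-- The unilateral shift `V₀ = W₀ | ℌ`, first entry of the characteristic pair. -/
def charShift (W : BiIsometry K) : W.shiftSpace →L[ℂ] W.shiftSpace :=
  (W.W₀.toContinuousLinearMap ∘L W.shiftSpace.subtypeL).codRestrict W.shiftSpace
    fun x => W.map_mem_shiftSpace x x.2

/-- The space `𝔈 = ℌ ⊖ V₀ ℌ` on which the characteristic function acts. -/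
abbrev charSpace (W : BiIsometry K) : Submodule ℂ W.shiftSpace :=
  defectSpace W.charShift

end Basic

variable {K : Type u} [NormedAddCommGroup K] [InnerProductSpace ℂ K] [CompleteSpace K]

instance (W : BiIsometry K) : CompleteSpace W.shiftSpace :=
  (Submodule.isClosed_topologicalClosure _).completeSpace_coe

/-- The contraction `A = P_ℌ W₁ | ℌ`, second entry of the characteristic pair. -/
def charContraction (W : BiIsometry K) : W.shiftSpace →L[ℂ] W.shiftSpace :=
  W.shiftSpace.orthogonalProjectionOnto ∘L W.W₁.toContinuousLinearMap ∘L W.shiftSpace.subtypeL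

/-- The characteristic function of a bi-isometry. -/
def charFunction (W : BiIsometry K) (z : ℂ) : W.charSpace →L[ℂ] W.charSpace :=
  pairFunction W.charShift W.charContraction z

end BiIsometry

section OperatorFunctions

variable {E : Type u} [NormedAddCommGroup E] [InnerProductSpace ℂ E]

/-- `Θ`, restricted to the open unit disk, is a contractive analytic function. -/
structure IsContractiveAnalytic (Θ : ℂ → E →L[ℂ] E) : Prop where
  analytic : AnalyticOnNhd ℂ Θ (Metric.ball 0 1)
  contractive : ∀ z ∈ Metric.ball (0 : ℂ) 1, ‖Θ z‖ ≤ 1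

/-- Unitary equivalence on the disk: `U Θ(z) = Θ'(z) U`, `|z| < 1`, for some unitary `U`. -/
def FunctionsUnitarilyEquivalent {E' : Type v} [NormedAddCommGroup E'] [InnerProductSpace ℂ E']
    (Θ : ℂ → E →L[ℂ] E) (Θ' : ℂ → E' →L[ℂ] E') : Prop :=
  ∃ U : E ≃ₗᵢ[ℂ] E', ∀ z ∈ Metric.ball (0 : ℂ) 1, ∀ x, U (Θ z x) = Θ' z (U x)

end OperatorFunctions

end

/-! Write `ℜ = ℌᗮ`. By Wold, `W₀` is a shift `V₀` on `ℌ` and unitary on `ℜ`. Since `W₀` maps `ℜ`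
onto itself and commutes with `W₁`, also `W₁ ℜ ⊆ ℜ`; hence the compression `A` commutes with `V₀`.
By the Neumann series the Taylor coefficients of `Θ` are `P_𝔈 V₀*ᵏ A | 𝔈`, that is, the numbers
`⟪V₀ᵏ f, A e⟫` with `e, f ∈ 𝔈`. The spaces `V₀ᵏ 𝔈` span `ℌ`, so `Θ` determines `A` on `𝔈`, and then
everywhere by commutation: `Θ` is a complete invariant of the pair `(V₀, A)` (`exists_pair_equiv`).

Additivity and invariance are naturality: an operator that intertwines two pairs and carries defect
space into defect space intertwines their functions (`pairFunction_intertwine`).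

Completeness needs the pair to determine a pure bi-isometry. Let `D = P_ℜ W₁ | ℌ`. As `W₁` is
isometric, `D*D = I - A*A` and the spaces `W₁ᵐ D ℌ` are mutually orthogonal; as `W₀ | ℜ` is unitary,
the Gram matrix of the vectors `W₀*ⁿ W₁ᵐ D h` can be written in terms of `V₀` and `A` alone
(`inner_orbit`). Together with `ℌ` these vectors span the smallest reducing subspace containing `ℌ`.
On its complement `W₀` is unitary, so purity makes the span dense, and equal Gram matrices give the
unitary operator (`exists_unitary_of_gram_eq`).

For realization, the Taylor coefficients of `Θ` act by convolution on `ℓ²(𝔉)`. Parseval makes this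
operator `A` a contraction (`sum_norm_sq_toeplitz_le`); it commutes with the shift `V`, and `Θ` is
the function of `(V, A)`. With `D = (I - A*A)^{1/2}`, the map `D h ↦ D V h` is isometric and extends
to a unitary `U`. Then `V ⊕ U ⊕ U ⊕ ⋯` and `(h, r₀, r₁, …) ↦ (A h, D h, r₀, r₁, …)` are commuting
isometries with function `Θ`. Cutting down to the reducing subspace generated by the shift space
gives purity and keeps the function (`exists_isZeroPure_part`). -/

noncomputable section

open scoped InnerProductSpace
open Filter Topology

/-! ### Isometries, their defect spaces, and the operator function of a pair -/

section Isometry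

variable {H : Type*} [NormedAddCommGroup H] [InnerProductSpace ℂ H]

theorem mem_defectSpace_iff {V : H →L[ℂ] H} {e : H} :
    e ∈ defectSpace V ↔ ∀ x, ⟪V x, e⟫_ℂ = 0 := by
  simp [defectSpace, Submodule.mem_orthogonal]

theorem ContinuousLinearMap.inner_map_map_of_norm {H' : Type*} [NormedAddCommGroup H']
    [InnerProductSpace ℂ H'] {V : H →L[ℂ] H'} (hV : ∀ x, ‖V x‖ = ‖x‖)
    (x y : H) : ⟪V x, V y⟫_ℂ = ⟪x, y⟫_ℂ :=
  LinearIsometry.inner_map_map ⟨(V : H →ₗ[ℂ] H'), hV⟩ x y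

theorem inner_pow_pow_defectSpace {V : H →L[ℂ] H} (hV : ∀ x, ‖V x‖ = ‖x‖) (k l : ℕ)
    {e f : H} (he : e ∈ defectSpace V) (hf : f ∈ defectSpace V) :
    ⟪(V ^ k) e, (V ^ l) f⟫_ℂ = if k = l then ⟪e, f⟫_ℂ else 0 := by
  induction k generalizing l with
  | zero =>
    cases l with
    | zero => simp
    | succ l =>
      rw [if_neg (by omega), pow_succ', ← inner_conj_symm]
      exact (congrArg _ (mem_defectSpace_iff.1 he ((V ^ l) f))).trans (map_zero _)
  | succ k ih =>
    cases l with
    | zero => simpa [pow_succ'] using mem_defectSpace_iff.1 hf ((V ^ k) e)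
    | succ l =>
      rw [pow_succ', pow_succ']
      exact (ContinuousLinearMap.inner_map_map_of_norm hV _ _).trans ((ih l).trans (by simp))

theorem norm_le_one_of_norm {V : H →L[ℂ] H} (hV : ∀ x, ‖V x‖ = ‖x‖) : ‖V‖ ≤ 1 :=
  V.opNorm_le_bound zero_le_one fun x => by rw [hV, one_mul]

variable [CompleteSpace H]

theorem adjoint_apply_of_norm {V : H →L[ℂ] H} (hV : ∀ x, ‖V x‖ = ‖x‖) (x : H) :
    V.adjoint (V x) = x :=
  ext_inner_left ℂ fun y => by
    rw [ContinuousLinearMap.adjoint_inner_right, ContinuousLinearMap.inner_map_map_of_norm hV]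

theorem adjoint_apply_of_mem_defectSpace {V : H →L[ℂ] H} {e : H} (he : e ∈ defectSpace V) :
    V.adjoint e = 0 :=
  ext_inner_left ℂ fun y => by
    rw [ContinuousLinearMap.adjoint_inner_right, mem_defectSpace_iff.1 he, inner_zero_right]

/-- The range of an isometry is closed, so it equals its double orthogonal complement. -/
theorem exists_of_forall_defectSpace {V : H →L[ℂ] H} (hV : ∀ x, ‖V x‖ = ‖x‖) {y : H}
    (hy : ∀ e ∈ defectSpace V, ⟪e, y⟫_ℂ = 0) : ∃ x, V x = y := by
  have hcl : IsClosed (LinearMap.range (V : H →ₗ[ℂ] H) : Set H) := by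
    have : Isometry V := AddMonoidHomClass.isometry_of_norm V hV
    rw [LinearMap.coe_range]
    exact this.isClosedEmbedding.isClosed_range
  have h : y ∈ (LinearMap.range (V : H →ₗ[ℂ] H))ᗮᗮ := (Submodule.mem_orthogonal _ _).2 hy
  rw [Submodule.orthogonal_orthogonal_eq_closure, hcl.submodule_topologicalClosure_eq] at h
  simpa using h

theorem norm_smul_adjoint_lt_one {V : H →L[ℂ] H} (hV : ‖V‖ ≤ 1) {z : ℂ} (hz : ‖z‖ < 1) :
    ‖z • V.adjoint‖ < 1 := by
  rw [norm_smul, LinearIsometryEquiv.norm_map]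
  nlinarith [norm_nonneg z, norm_nonneg V]

theorem adjoint_pow_inner (V : H →L[ℂ] H) (k : ℕ) (x y : H) :
    ⟪x, (V.adjoint ^ k) y⟫_ℂ = ⟪(V ^ k) x, y⟫_ℂ := by
  rw [← ContinuousLinearMap.star_eq_adjoint, ← star_pow, ContinuousLinearMap.star_eq_adjoint,
    ContinuousLinearMap.adjoint_inner_right]

theorem inner_pairFunction (V A : H →L[ℂ] H) (z : ℂ) (e f : defectSpace V) :
    ⟪f, pairFunction V A z e⟫_ℂ = ⟪(f : H), Ring.inverse (1 - z • V.adjoint) (A e)⟫_ℂ := by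
  have : CompleteSpace (defectSpace V) := Submodule.instOrthogonalCompleteSpace _
  rw [pairFunction]
  exact Submodule.inner_orthogonalProjectionOnto_eq_of_mem_left f _

/-- Neumann series of the resolvent, with `V*ᵏ` moved to the left entry. The function enters the
completeness and realization arguments through these weak Taylor coefficients. -/
theorem hasSum_inner_pairFunction {V : H →L[ℂ] H} (hV : ‖V‖ ≤ 1) (A : H →L[ℂ] H) {z : ℂ}
    (hz : ‖z‖ < 1) (e f : defectSpace V) :
    HasSum (fun k : ℕ => z ^ k * ⟪(V ^ k) f, A e⟫_ℂ) ⟪f, pairFunction V A z e⟫_ℂ := by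
  have h := hasSum_geom_series_inverse _ (norm_smul_adjoint_lt_one hV hz)
  have h' := h.mapL ((innerSL ℂ (f : H)) ∘L (ContinuousLinearMap.apply ℂ H (A e)))
  rw [inner_pairFunction]
  refine h'.congr_fun fun k => ?_
  change _ = ⟪(f : H), ((z • V.adjoint) ^ k) (A e)⟫_ℂ
  rw [smul_pow, smul_apply, inner_smul_right, adjoint_pow_inner]

theorem one_sub_inverse_apply {V : H →L[ℂ] H} (hV : ‖V‖ ≤ 1) {z : ℂ} (hz : ‖z‖ < 1) (x : H) :
    (1 - z • V.adjoint) (Ring.inverse (1 - z • V.adjoint) x) = x :=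
   congrArg (fun S : H →L[ℂ] H => S x) (Ring.mul_inverse_cancel _
    (isUnit_one_sub_of_norm_lt_one (norm_smul_adjoint_lt_one hV hz)))

theorem inverse_one_sub_apply {V : H →L[ℂ] H} (hV : ‖V‖ ≤ 1) {z : ℂ} (hz : ‖z‖ < 1) (x : H) :
    Ring.inverse (1 - z • V.adjoint) ((1 - z • V.adjoint) x) = x := by
  exact congrArg (fun S : H →L[ℂ] H => S x) (Ring.inverse_mul_cancel _
    (isUnit_one_sub_of_norm_lt_one (norm_smul_adjoint_lt_one hV hz)))

/-- The vector `x - V V* x` lies in the defect space, so `V'*` kills its image under `T`; expanding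
that gives the claim. -/
theorem map_adjoint_of_intertwine {H' : Type*} [NormedAddCommGroup H'] [InnerProductSpace ℂ H']
    [CompleteSpace H'] {V : H →L[ℂ] H} {V' : H' →L[ℂ] H'} (hV : ∀ x, ‖V x‖ = ‖x‖)
    (hV' : ∀ x, ‖V' x‖ = ‖x‖) (T : H →L[ℂ] H') (hTV : ∀ x, T (V x) = V' (T x))
    (hTE : ∀ e ∈ defectSpace V, T e ∈ defectSpace V') (x : H) :
    T (V.adjoint x) = V'.adjoint (T x) := by
  have hx : x - V (V.adjoint x) ∈ defectSpace V := mem_defectSpace_iff.2 fun y => by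
    rw [inner_sub_right, ContinuousLinearMap.inner_map_map_of_norm hV,
      ContinuousLinearMap.adjoint_inner_right, sub_self]
  have h := adjoint_apply_of_mem_defectSpace (hTE _ hx)
  rw [map_sub, map_sub, hTV, adjoint_apply_of_norm hV', sub_eq_zero] at h
  exact h.symm

/-- An operator intertwining two pairs and respecting the defect spaces intertwines the two
operator functions. -/
theorem pairFunction_intertwine {H' : Type*} [NormedAddCommGroup H'] [InnerProductSpace ℂ H']
    [CompleteSpace H'] {V A : H →L[ℂ] H} {V' A' : H' →L[ℂ] H'} (hV : ∀ x, ‖V x‖ = ‖x‖)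
    (hV' : ∀ x, ‖V' x‖ = ‖x‖) (T : H →L[ℂ] H') (hTV : ∀ x, T (V x) = V' (T x))
    (hTE : ∀ e ∈ defectSpace V, T e ∈ defectSpace V') (hTA : ∀ x, T (A x) = A' (T x))
    {z : ℂ} (hz : ‖z‖ < 1) (e : defectSpace V) :
    (⟨T (pairFunction V A z e), hTE _ (Subtype.coe_prop _)⟩ : defectSpace V') =
      pairFunction V' A' z ⟨T e, hTE _ e.2⟩ := by
  refine ext_inner_left ℂ fun f => ?_
  rw [inner_pairFunction]
  have : CompleteSpace (defectSpace V) := Submodule.instOrthogonalCompleteSpace _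
  set y := Ring.inverse (1 - z • V.adjoint) (A e) with hy
  have hTy : Ring.inverse (1 - z • V'.adjoint) (A' (T e)) = T y := by
    rw [← hTA, ← one_sub_inverse_apply (norm_le_one_of_norm hV) hz (A e), ← hy]
    have : T ((1 - z • V.adjoint) y) = (1 - z • V'.adjoint) (T y) := by
      simp [map_adjoint_of_intertwine hV hV' T hTV hTE]
    rw [this, inverse_one_sub_apply (norm_le_one_of_norm hV') hz]
  -- `y` minus its projection to the defect space lies in the range of `V`, so `T` sends it into the
  -- range of `V'`, orthogonal to `f`. Thus `T` commutes with the two projections as far as `f` can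
  -- see.
  obtain ⟨w, hw⟩ := exists_of_forall_defectSpace hV (y := y - pairFunction V A z e) fun e' he' => by
    have := inner_pairFunction V A z e ⟨e', he'⟩
    rw [inner_sub_right, sub_eq_zero, ← hy] at *
    exact this.symm
  have h2 : ⟪(f : H'), V' (T w)⟫_ℂ = 0 := by
    rw [← inner_conj_symm, mem_defectSpace_iff.1 f.2, map_zero]
  rw [← hTV, hw, map_sub, inner_sub_right, sub_eq_zero] at h2
  rw [hTy, h2]
  rfl

end Isometry

/-- Two scalar power series with the same sum on the unit disk have the same coefficients. -/
theorem coeff_unique_of_hasSum {c d : ℕ → ℂ} {f : ℂ → ℂ}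
    (hc : ∀ z : ℂ, ‖z‖ < 1 → HasSum (fun k => z ^ k * c k) (f z))
    (hd : ∀ z : ℂ, ‖z‖ < 1 → HasSum (fun k => z ^ k * d k) (f z)) : c = d := by
  have key : ∀ c : ℕ → ℂ, (∀ z : ℂ, ‖z‖ < 1 → HasSum (fun k => z ^ k * c k) (f z)) →
      HasFPowerSeriesAt f ((fun n => ContinuousMultilinearMap.mkPiRing ℂ (Fin n) (c n) :
        FormalMultilinearSeries ℂ ℂ ℂ)) 0 := fun c hc => by
    refine hasFPowerSeriesAt_iff.2 ?_
    filter_upwards [Metric.ball_mem_nhds (0 : ℂ) one_pos] with z hz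
    simpa [FormalMultilinearSeries.coeff] using hc z (by simpa using hz)
  have h := (key c hc).eq_formalMultilinearSeries (key d hd)
  funext n
  simpa [FormalMultilinearSeries.coeff] using congrArg (fun p => FormalMultilinearSeries.coeff p n) h

namespace BiIsometry

/-! ### Wold decomposition of the first isometry and the characteristic pair -/

section Wold

variable {K : Type*} [NormedAddCommGroup K] [InnerProductSpace ℂ K] (W : BiIsometry K)

theorem mem_defectSpace_W₀ {e : K} :
    e ∈ defectSpace W.W₀.toContinuousLinearMap ↔ ∀ x, ⟪W.W₀ x, e⟫_ℂ = 0 :=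
  mem_defectSpace_iff

theorem pow_defect_mem_shiftSpace (k : ℕ) {e : K}
    (he : e ∈ defectSpace W.W₀.toContinuousLinearMap) :
    (W.W₀.toContinuousLinearMap ^ k) e ∈ W.shiftSpace := by
  induction k with
  | zero =>
    exact Submodule.le_topologicalClosure _ (Submodule.mem_iSup_of_mem 0 ⟨e, he, rfl⟩)
  | succ k ih =>
    rw [pow_succ']
    exact W.map_mem_shiftSpace _ ih

theorem defect_mem_shiftSpace {e : K} (he : e ∈ defectSpace W.W₀.toContinuousLinearMap) :
    e ∈ W.shiftSpace := W.pow_defect_mem_shiftSpace 0 he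

theorem shiftSpace_le {M : Submodule ℂ K} (hM : IsClosed (M : Set K))
    (h : ∀ (k : ℕ), ∀ e ∈ defectSpace W.W₀.toContinuousLinearMap,
      (W.W₀.toContinuousLinearMap ^ k) e ∈ M) : W.shiftSpace ≤ M := by
  refine Submodule.topologicalClosure_minimal _ (iSup_le fun k => ?_) hM
  rintro _ ⟨y, hy, rfl⟩
  convert h k y hy using 1
  clear hy
  induction k with
  | zero => rfl
  | succ k ih =>
    rw [pow_succ', pow_succ']
    exact congrArg W.W₀ ih

theorem shiftSpace_le_of_invariant {M : Submodule ℂ K} (hM : IsClosed (M : Set K))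
    (hE : ∀ e ∈ defectSpace W.W₀.toContinuousLinearMap, e ∈ M) (h : ∀ x ∈ M, W.W₀ x ∈ M) :
    W.shiftSpace ≤ M :=
  W.shiftSpace_le hM fun k e he => by
    induction k with
    | zero => exact hE e he
    | succ k ih =>
      rw [pow_succ']
      exact h _ ih

theorem map_mem_shiftSpace_of_intertwine {K' : Type*} [NormedAddCommGroup K']
    [InnerProductSpace ℂ K'] (W' : BiIsometry K') (T : K →L[ℂ] K')
    (hT : ∀ x, T (W.W₀ x) = W'.W₀ (T x))
    (hE : ∀ e ∈ defectSpace W.W₀.toContinuousLinearMap,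
      T e ∈ defectSpace W'.W₀.toContinuousLinearMap) {x : K} (hx : x ∈ W.shiftSpace) :
    T x ∈ W'.shiftSpace := by
  have hcl : IsClosed (W'.shiftSpace.comap (T : K →ₗ[ℂ] K') : Set K) :=
    (Submodule.isClosed_topologicalClosure _).preimage T.continuous
  refine W.shiftSpace_le_of_invariant hcl (fun e he => W'.defect_mem_shiftSpace (hE e he))
    (fun x hx => ?_) hx
  have := W'.map_mem_shiftSpace _ hx
  rw [Submodule.mem_comap]
  simpa [hT] using this

theorem mem_shiftSpace_orthogonal_iff {r : K} : r ∈ W.shiftSpaceᗮ ↔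
    ∀ (k : ℕ), ∀ e ∈ defectSpace W.W₀.toContinuousLinearMap,
      ⟪(W.W₀.toContinuousLinearMap ^ k) e, r⟫_ℂ = 0 := by
  refine ⟨fun h k e he => (Submodule.mem_orthogonal _ _).1 h _ (W.pow_defect_mem_shiftSpace k he),
    fun h => ?_⟩
  have : W.shiftSpace ≤ (ℂ ∙ r)ᗮ := W.shiftSpace_le (Submodule.isClosed_orthogonal _)
    fun k e he => Submodule.mem_orthogonal_singleton_iff_inner_left.2 (h k e he)
  exact (Submodule.mem_orthogonal _ _).2 fun x hx =>
    Submodule.mem_orthogonal_singleton_iff_inner_left.1 (this hx)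

theorem W₀_mem_orthogonal {r : K} (hr : r ∈ W.shiftSpaceᗮ) : W.W₀ r ∈ W.shiftSpaceᗮ := by
  rw [mem_shiftSpace_orthogonal_iff] at *
  rintro (_ | k) e he
  · rw [← inner_conj_symm]
    simp [W.mem_defectSpace_W₀.1 he]
  · rw [pow_succ']
    exact (W.W₀.inner_map_map _ _).trans (hr k e he)

theorem charShift_coe (x : W.shiftSpace) : (W.charShift x : K) = W.W₀ x := rfl

theorem norm_charShift (x : W.shiftSpace) : ‖W.charShift x‖ = ‖x‖ := W.W₀.norm_map _

theorem charShift_pow_coe (k : ℕ) (x : W.shiftSpace) :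
    (((W.charShift ^ k) x : W.shiftSpace) : K) = (W.W₀.toContinuousLinearMap ^ k) x := by
  induction k with
  | zero => rfl
  | succ k ih =>
    rw [pow_succ', pow_succ']
    exact congrArg W.W₀ ih

variable [CompleteSpace K]

/-- Since `W₀` preserves the complement of the shift space, that part of `W₀ 𝔎` is orthogonal to `x`
automatically; so `ℌ ⊖ V₀ ℌ = 𝔎 ⊖ W₀ 𝔎`. -/
theorem mem_charSpace_iff {x : W.shiftSpace} :
    x ∈ W.charSpace ↔ (x : K) ∈ defectSpace W.W₀.toContinuousLinearMap := by
  rw [mem_defectSpace_iff, mem_defectSpace_W₀]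
  refine ⟨fun h y => ?_, fun h y => h y⟩
  obtain ⟨a, ha, b, hb, rfl⟩ := W.shiftSpace.exists_add_mem_mem_orthogonal y
  rw [map_add, inner_add_left, (Submodule.mem_orthogonal' _ _).1 (W.W₀_mem_orthogonal hb) _ x.2,
    add_zero]
  exact h ⟨a, ha⟩

/-- The unitary half of the Wold decomposition. Orthogonality to the defect space (`k = 0`) gives a
preimage; the conditions for `k + 1` on `r` are those for `k` on the preimage. -/
theorem exists_W₀_eq {r : K} (hr : r ∈ W.shiftSpaceᗮ) :
    ∃ s ∈ W.shiftSpaceᗮ, W.W₀ s = r := by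
  rw [mem_shiftSpace_orthogonal_iff] at hr
  obtain ⟨s, hs⟩ := exists_of_forall_defectSpace (V := W.W₀.toContinuousLinearMap)
    (fun x => W.W₀.norm_map x) (hr 0)
  refine ⟨s, W.mem_shiftSpace_orthogonal_iff.2 fun k e he => ?_, hs⟩
  rw [← hr (k + 1) e he, ← hs, pow_succ']
  exact (W.W₀.inner_map_map _ _).symm

/-- Write `r = W₀ s` with `s` again in the complement. Commutation gives `W₁ r = W₀ (W₁ s)`, which
is orthogonal to the defect space, and each power of `W₀` can be peeled off in the same way. -/
theorem W₁_mem_orthogonal {r : K} (hr : r ∈ W.shiftSpaceᗮ) : W.W₁ r ∈ W.shiftSpaceᗮ := by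
  rw [mem_shiftSpace_orthogonal_iff]
  intro k e he
  induction k generalizing r with
  | zero =>
    obtain ⟨s, -, rfl⟩ := W.exists_W₀_eq hr
    rw [← W.comm, ← inner_conj_symm]
    simp [W.mem_defectSpace_W₀.1 he]
  | succ k ih =>
    obtain ⟨s, hs, rfl⟩ := W.exists_W₀_eq hr
    rw [← W.comm, pow_succ', ← ih hs]
    exact W.W₀.inner_map_map _ _

/-- The adjoint of the first isometry. -/
def adj₀ : K →L[ℂ] K := W.W₀.toContinuousLinearMap.adjoint

/-- The adjoint of the second isometry. -/
def adj₁ : K →L[ℂ] K := W.W₁.toContinuousLinearMap.adjoint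

theorem adj₀_inner (x y : K) : ⟪W.adj₀ x, y⟫_ℂ = ⟪x, W.W₀ y⟫_ℂ :=
  ContinuousLinearMap.adjoint_inner_left _ _ _

theorem adj₁_inner (x y : K) : ⟪W.adj₁ x, y⟫_ℂ = ⟪x, W.W₁ y⟫_ℂ :=
  ContinuousLinearMap.adjoint_inner_left _ _ _

theorem adj₀_W₀ (x : K) : W.adj₀ (W.W₀ x) = x :=
  adjoint_apply_of_norm (V := W.W₀.toContinuousLinearMap) (fun x => W.W₀.norm_map x) x

theorem adj₁_W₁ (x : K) : W.adj₁ (W.W₁ x) = x :=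
  adjoint_apply_of_norm (V := W.W₁.toContinuousLinearMap) (fun x => W.W₁.norm_map x) x

theorem adj₁_adj₀ (x : K) : W.adj₁ (W.adj₀ x) = W.adj₀ (W.adj₁ x) :=
  ext_inner_right ℂ fun y => by simp only [adj₀_inner, adj₁_inner, W.comm]

theorem adj₀_mem_orthogonal {r : K} (hr : r ∈ W.shiftSpaceᗮ) : W.adj₀ r ∈ W.shiftSpaceᗮ := by
  obtain ⟨s, hs, rfl⟩ := W.exists_W₀_eq hr
  rwa [adj₀_W₀]

theorem W₀_adj₀ {r : K} (hr : r ∈ W.shiftSpaceᗮ) : W.W₀ (W.adj₀ r) = r := by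
  obtain ⟨s, hs, rfl⟩ := W.exists_W₀_eq hr
  rw [adj₀_W₀]

theorem W₁_adj₀ {r : K} (hr : r ∈ W.shiftSpaceᗮ) : W.W₁ (W.adj₀ r) = W.adj₀ (W.W₁ r) := by
  obtain ⟨s, hs, rfl⟩ := W.exists_W₀_eq hr
  rw [adj₀_W₀, ← W.comm, adj₀_W₀]

theorem mem_shiftSpace_of_forall {x : K} (h : ∀ r ∈ W.shiftSpaceᗮ, ⟪x, r⟫_ℂ = 0) :
    x ∈ W.shiftSpace := by
  rw [← W.shiftSpace.orthogonal_orthogonal]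
  exact (Submodule.mem_orthogonal' _ _).2 h

theorem adj₀_mem_shiftSpace {x : K} (hx : x ∈ W.shiftSpace) : W.adj₀ x ∈ W.shiftSpace :=
  W.mem_shiftSpace_of_forall fun r hr => by
    rw [adj₀_inner]
    exact (Submodule.mem_orthogonal _ _).1 (W.W₀_mem_orthogonal hr) x hx

theorem adj₁_mem_shiftSpace {x : K} (hx : x ∈ W.shiftSpace) : W.adj₁ x ∈ W.shiftSpace :=
  W.mem_shiftSpace_of_forall fun r hr => by
    rw [adj₁_inner]
    exact (Submodule.mem_orthogonal _ _).1 (W.W₁_mem_orthogonal hr) x hx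

theorem W₁_sub_charContraction_mem (x : W.shiftSpace) :
    W.W₁ x - W.charContraction x ∈ W.shiftSpaceᗮ :=
  W.shiftSpace.sub_starProjection_mem_orthogonal (W.W₁ x)

theorem charContraction_coe_eq {x : W.shiftSpace} {y : K} (hy : y ∈ W.shiftSpace)
    (h : W.W₁ x - y ∈ W.shiftSpaceᗮ) : (W.charContraction x : K) = y :=
  W.shiftSpace.eq_starProjection_of_mem_orthogonal hy h

theorem charContraction_charShift (x : W.shiftSpace) :
    W.charContraction (W.charShift x) = W.charShift (W.charContraction x) :=
  Subtype.ext <| W.charContraction_coe_eq (Subtype.coe_prop _) <| by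
    rw [charShift_coe, charShift_coe, ← W.comm, ← map_sub]
    exact W.W₀_mem_orthogonal (W.W₁_sub_charContraction_mem x)

/-- The translates of the defect space are total in the shift space; this is the vanishing test used
for density and for identifying `A`. -/
theorem eq_bot_of_shiftSpace (h : W.shiftSpace) (hh : ∀ (k : ℕ), ∀ e ∈ W.charSpace,
    ⟪(W.charShift ^ k) e, h⟫_ℂ = 0) : h = 0 := by
  have : (h : K) ∈ W.shiftSpaceᗮ := W.mem_shiftSpace_orthogonal_iff.2 fun k e he => by
    have := hh k ⟨e, W.defect_mem_shiftSpace he⟩ (W.mem_charSpace_iff.2 he)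
    rwa [Submodule.coe_inner, charShift_pow_coe] at this
  exact Subtype.ext (Submodule.disjoint_def.1 W.shiftSpace.orthogonal_disjoint _ h.2 this)

end Wold

end BiIsometry

namespace BiIsometry

/-! ### Naturality and unitary invariance of the characteristic function -/

section Functoriality

variable {K : Type*} [NormedAddCommGroup K] [InnerProductSpace ℂ K]
  {K' : Type*} [NormedAddCommGroup K'] [InnerProductSpace ℂ K']

theorem defect_map_of_equiv {W : BiIsometry K} {W' : BiIsometry K'} (U : K ≃ₗᵢ[ℂ] K')
    (h : ∀ x, U (W.W₀ x) = W'.W₀ (U x)) {e : K}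
    (he : e ∈ defectSpace W.W₀.toContinuousLinearMap) :
    U e ∈ defectSpace W'.W₀.toContinuousLinearMap :=
  W'.mem_defectSpace_W₀.2 fun x => by
    rw [← U.apply_symm_apply x, ← h, U.inner_map_map]
    exact W.mem_defectSpace_W₀.1 he _

variable [CompleteSpace K] [CompleteSpace K']

/-- An operator between the ambient spaces that intertwines the first isometries, respects their
defect spaces, and intertwines the second isometries up to vectors orthogonal to the shift space,
intertwines the characteristic functions. -/
theorem charFunction_intertwine (W : BiIsometry K) (W' : BiIsometry K') (T : K →L[ℂ] K')
    (hT : ∀ x, T (W.W₀ x) = W'.W₀ (T x))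
    (hE : ∀ e ∈ defectSpace W.W₀.toContinuousLinearMap,
      T e ∈ defectSpace W'.W₀.toContinuousLinearMap)
    (hA : ∀ x : W.shiftSpace, W'.W₁ (T x) - T (W.charContraction x) ∈ W'.shiftSpaceᗮ)
    {z : ℂ} (hz : ‖z‖ < 1) (e : W.charSpace) (e' : W'.charSpace)
    (he : ((e' : W'.shiftSpace) : K') = T (e : W.shiftSpace)) :
    ((W'.charFunction z e' : W'.shiftSpace) : K') = T (W.charFunction z e : W.shiftSpace) := by
  let S : W.shiftSpace →L[ℂ] W'.shiftSpace :=
    (T ∘L W.shiftSpace.subtypeL).codRestrict W'.shiftSpace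
      fun x => W.map_mem_shiftSpace_of_intertwine W' T hT hE x.2
  have hS : ∀ x, ((S x : W'.shiftSpace) : K') = T x := fun _ => rfl
  have hSE : ∀ e ∈ W.charSpace, S e ∈ W'.charSpace := fun e he =>
    W'.mem_charSpace_iff.2 (hE _ (W.mem_charSpace_iff.1 he))
  have h := pairFunction_intertwine (A := W.charContraction) (A' := W'.charContraction)
    W.norm_charShift W'.norm_charShift S (fun x => Subtype.ext (hT x)) hSE
    (fun x => Subtype.ext (W'.charContraction_coe_eq (S _).2 (hA x)).symm) hz e
  have he' : e' = ⟨S e, hSE e e.2⟩ := Subtype.ext (Subtype.ext he)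
  rw [he']
  exact (congrArg (fun y : W'.charSpace => ((y : W'.shiftSpace) : K')) h).symm

/-- A map of ambient spaces restricting to an isometry of the defect spaces and satisfying the
conditions of `charFunction_intertwine` makes the characteristic functions equivalent. -/
theorem functionsUnitarilyEquivalent_of_intertwine (W : BiIsometry K) (W' : BiIsometry K')
    (T : K →ₗᵢ[ℂ] K')
    (hT : ∀ x, T (W.W₀ x) = W'.W₀ (T x))
    (hE : ∀ e ∈ defectSpace W.W₀.toContinuousLinearMap,
      T e ∈ defectSpace W'.W₀.toContinuousLinearMap)
    (hsurj : ∀ e' ∈ defectSpace W'.W₀.toContinuousLinearMap,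
      ∃ e ∈ defectSpace W.W₀.toContinuousLinearMap, T e = e')
    (hA : ∀ x : W.shiftSpace, W'.W₁ (T x) - T (W.charContraction x) ∈ W'.shiftSpaceᗮ) :
    FunctionsUnitarilyEquivalent W.charFunction W'.charFunction := by
  have hmem : ∀ e : W.charSpace, T (e : W.shiftSpace) ∈
      defectSpace W'.W₀.toContinuousLinearMap := fun e => hE _ (W.mem_charSpace_iff.1 e.2)
  let J : W.charSpace →ₗᵢ[ℂ] W'.charSpace :=
    { toFun := fun e => ⟨⟨T (e : W.shiftSpace), W'.defect_mem_shiftSpace (hmem e)⟩,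
        W'.mem_charSpace_iff.2 (hmem e)⟩
      map_add' := fun x y => Subtype.ext (Subtype.ext (map_add T _ _))
      map_smul' := fun c x => Subtype.ext (Subtype.ext (map_smul T _ _))
      norm_map' := fun x => T.norm_map _ }
  have hJ : Function.Surjective J := fun e' => by
    obtain ⟨e, he, h⟩ := hsurj _ (W'.mem_charSpace_iff.1 e'.2)
    exact ⟨⟨⟨e, W.defect_mem_shiftSpace he⟩, W.mem_charSpace_iff.2 he⟩,
      Subtype.ext (Subtype.ext h)⟩
  refine ⟨LinearIsometryEquiv.ofSurjective J hJ, fun z hz x => ?_⟩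
  refine Subtype.ext (Subtype.ext ?_)
  exact (charFunction_intertwine W W' T.toContinuousLinearMap hT hE hA (by simpa using hz) x
    (J x) rfl).symm

theorem UnitarilyEquivalent.functionsUnitarilyEquivalent {W : BiIsometry K} {W' : BiIsometry K'}
    (h : W.UnitarilyEquivalent W') :
    FunctionsUnitarilyEquivalent W.charFunction W'.charFunction := by
  obtain ⟨U, h₀, h₁⟩ := h
  have h₀' : ∀ x, U.symm (W'.W₀ x) = W.W₀ (U.symm x) := fun x => by
    rw [U.symm_apply_eq, h₀, U.apply_symm_apply]
  refine functionsUnitarilyEquivalent_of_intertwine W W' U.toLinearIsometry h₀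
    (fun e => defect_map_of_equiv U h₀)
    (fun e he => ⟨U.symm e, defect_map_of_equiv U.symm h₀' he, U.apply_symm_apply e⟩) fun x => ?_
  refine (Submodule.mem_orthogonal _ _).2 fun y hy => ?_
  have hy' : U.symm y ∈ W.shiftSpace :=
    W'.map_mem_shiftSpace_of_intertwine W (U.symm : K' →L[ℂ] K) h₀'
      (fun e => defect_map_of_equiv U.symm h₀') hy
  have := (Submodule.mem_orthogonal _ _).1 (W.W₁_sub_charContraction_mem x) _ hy'
  change ⟪y, W'.W₁ (U x) - U _⟫_ℂ = 0
  rwa [← U.inner_map_map (U.symm y), U.apply_symm_apply, map_sub, h₁] at this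

end Functoriality

/-! ### Direct sums -/

section DirectSum

variable {K : Type*} [NormedAddCommGroup K] [InnerProductSpace ℂ K]
  {K' : Type*} [NormedAddCommGroup K'] [InnerProductSpace ℂ K']
  (W : BiIsometry K) (W' : BiIsometry K')

theorem mem_defectSpace_directSum {e : WithLp 2 (K × K')} :
    e ∈ defectSpace (W.directSum W').W₀.toContinuousLinearMap ↔
      e.fst ∈ defectSpace W.W₀.toContinuousLinearMap ∧
        e.snd ∈ defectSpace W'.W₀.toContinuousLinearMap := by
  simp only [mem_defectSpace_W₀]
  refine ⟨fun h => ⟨fun x => ?_, fun x => ?_⟩, fun h x => ?_⟩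
  · simpa [directSum, isometryDirectSum] using h (WithLp.toLp 2 (x, 0))
  · simpa [directSum, isometryDirectSum] using h (WithLp.toLp 2 (0, x))
  · simp [directSum, isometryDirectSum, h.1, h.2]

theorem fst_mem_shiftSpace {x : WithLp 2 (K × K')} (hx : x ∈ (W.directSum W').shiftSpace) :
    x.fst ∈ W.shiftSpace :=
  (W.directSum W').map_mem_shiftSpace_of_intertwine W (WithLp.fstL 2 ℂ K K') (fun _ => rfl)
    (fun _ he => ((W.mem_defectSpace_directSum W').1 he).1) hx

theorem snd_mem_shiftSpace {x : WithLp 2 (K × K')} (hx : x ∈ (W.directSum W').shiftSpace) :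
    x.snd ∈ W'.shiftSpace :=
  (W.directSum W').map_mem_shiftSpace_of_intertwine W' (WithLp.sndL 2 ℂ K K') (fun _ => rfl)
    (fun _ he => ((W.mem_defectSpace_directSum W').1 he).2) hx

/-- The inclusion of the first summand. -/
def sumInl (K K' : Type*) [NormedAddCommGroup K] [InnerProductSpace ℂ K]
    [NormedAddCommGroup K'] [InnerProductSpace ℂ K'] : K →ₗᵢ[ℂ] WithLp 2 (K × K') where
  toFun x := WithLp.toLp 2 (x, 0)
  map_add' x y := by apply (WithLp.equiv 2 _).injective; ext <;> simp
  map_smul' c x := by apply (WithLp.equiv 2 _).injective; ext <;> simp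
  norm_map' x := by simp

/-- The inclusion of the second summand. -/
def sumInr (K K' : Type*) [NormedAddCommGroup K] [InnerProductSpace ℂ K]
    [NormedAddCommGroup K'] [InnerProductSpace ℂ K'] : K' →ₗᵢ[ℂ] WithLp 2 (K × K') where
  toFun x := WithLp.toLp 2 (0, x)
  map_add' x y := by apply (WithLp.equiv 2 _).injective; ext <;> simp
  map_smul' c x := by apply (WithLp.equiv 2 _).injective; ext <;> simp
  norm_map' x := by simp

variable [CompleteSpace K] [CompleteSpace K']

theorem exists_charSpace_directSum_equiv :
    ∃ J : WithLp 2 (W.charSpace × W'.charSpace) ≃ₗᵢ[ℂ] (W.directSum W').charSpace,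
      ∀ x, (((J x : (W.directSum W').shiftSpace)) : WithLp 2 (K × K')) =
        WithLp.toLp 2 (((x.fst : W.shiftSpace) : K), ((x.snd : W'.shiftSpace) : K')) := by
  have hmem : ∀ x : WithLp 2 (W.charSpace × W'.charSpace),
      WithLp.toLp 2 (((x.fst : W.shiftSpace) : K), ((x.snd : W'.shiftSpace) : K')) ∈
        defectSpace (W.directSum W').W₀.toContinuousLinearMap := fun x =>
    (W.mem_defectSpace_directSum W').2
      ⟨W.mem_charSpace_iff.1 x.fst.2, W'.mem_charSpace_iff.1 x.snd.2⟩
  let J : WithLp 2 (W.charSpace × W'.charSpace) →ₗᵢ[ℂ] (W.directSum W').charSpace :=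
    { toFun := fun x => ⟨⟨_, (W.directSum W').defect_mem_shiftSpace (hmem x)⟩,
        (W.directSum W').mem_charSpace_iff.2 (hmem x)⟩
      map_add' := fun x y => rfl
      map_smul' := fun c x => rfl
      norm_map' := fun x => by
        rw [WithLp.prod_norm_eq_of_L2]
        exact WithLp.prod_norm_eq_of_L2 _ }
  have hJ : Function.Surjective J := fun y => by
    have h := (W.mem_defectSpace_directSum W').1 ((W.directSum W').mem_charSpace_iff.1 y.2)
    exact ⟨WithLp.toLp 2 (⟨⟨_, W.defect_mem_shiftSpace h.1⟩, W.mem_charSpace_iff.2 h.1⟩,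
      ⟨⟨_, W'.defect_mem_shiftSpace h.2⟩, W'.mem_charSpace_iff.2 h.2⟩), rfl⟩
  exact ⟨LinearIsometryEquiv.ofSurjective J hJ, fun x => rfl⟩

/-- Both inclusions satisfy the hypotheses of `charFunction_intertwine`: coordinates of vectors in
the big shift space lie in the small ones, so the error terms remain orthogonal. Linearity then
combines the two summands. -/
theorem charFunction_directSum
    (J : WithLp 2 (W.charSpace × W'.charSpace) ≃ₗᵢ[ℂ] (W.directSum W').charSpace)
    (hJ : ∀ x, (((J x : (W.directSum W').shiftSpace)) : WithLp 2 (K × K')) =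
        WithLp.toLp 2 (((x.fst : W.shiftSpace) : K), ((x.snd : W'.shiftSpace) : K')))
    {z : ℂ} (hz : ‖z‖ < 1) (x : WithLp 2 (W.charSpace × W'.charSpace)) :
    (W.directSum W').charFunction z (J x) =
      J (WithLp.toLp 2 (W.charFunction z x.fst, W'.charFunction z x.snd)) := by
  have h1 := charFunction_intertwine W (W.directSum W') (sumInl K K').toContinuousLinearMap
    (fun x => by simp [sumInl, directSum, isometryDirectSum])
    (fun e he => (W.mem_defectSpace_directSum W').2 ⟨he, zero_mem _⟩)
    (fun x => (Submodule.mem_orthogonal _ _).2 fun y hy => by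
      have := (Submodule.mem_orthogonal _ _).1 (W.W₁_sub_charContraction_mem x) _
        (W.fst_mem_shiftSpace W' hy)
      simpa [sumInl, directSum, isometryDirectSum] using this) hz x.fst
    (J (WithLp.toLp 2 (x.fst, 0))) (hJ _)
  have h2 := charFunction_intertwine W' (W.directSum W') (sumInr K K').toContinuousLinearMap
    (fun x => by simp [sumInr, directSum, isometryDirectSum])
    (fun e he => (W.mem_defectSpace_directSum W').2 ⟨zero_mem _, he⟩)
    (fun x => (Submodule.mem_orthogonal _ _).2 fun y hy => by
      have := (Submodule.mem_orthogonal _ _).1 (W'.W₁_sub_charContraction_mem x) _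
        (W.snd_mem_shiftSpace W' hy)
      simpa [sumInr, directSum, isometryDirectSum] using this) hz x.snd
    (J (WithLp.toLp 2 (0, x.snd))) (hJ _)
  have hx : x = WithLp.toLp 2 (x.fst, 0) + WithLp.toLp 2 (0, x.snd) := by
    apply (WithLp.equiv 2 _).injective; ext <;> simp
  refine Subtype.ext (Subtype.ext ?_)
  rw [hJ]
  conv_lhs => rw [hx]
  rw [map_add, map_add, Submodule.coe_add, Submodule.coe_add, h1, h2]
  apply (WithLp.equiv 2 _).injective
  ext <;> simp [sumInl, sumInr]

end DirectSum

end BiIsometry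

/-! ### Unitary operators from equal Gram matrices -/

section Gram

variable {E : Type*} [NormedAddCommGroup E] [InnerProductSpace ℂ E]
  {E' : Type*} [NormedAddCommGroup E'] [InnerProductSpace ℂ E']

/-- A norm preserving correspondence `f x ↦ g x` with dense domain extends to an isometry. -/
theorem exists_isometry_of_norm_eq [CompleteSpace E'] {X : Type*} [AddCommGroup X] [Module ℂ X]
    (f : X →ₗ[ℂ] E) (g : X →ₗ[ℂ] E') (hfg : ∀ x, ‖g x‖ = ‖f x‖) (hf : DenseRange f) :
    ∃ L : E →ₗᵢ[ℂ] E', ∀ x, L (f x) = g x := by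
  have hC : ∃ C, ∀ x, ‖g x‖ ≤ C * ‖f x‖ := ⟨1, fun x => by rw [hfg, one_mul]⟩
  have hL := LinearMap.extendOfNorm_eq hf hC
  refine ⟨⟨(g.extendOfNorm f : E →ₗ[ℂ] E'), fun y => ?_⟩, hL⟩
  refine hf.induction_on (p := fun y => ‖g.extendOfNorm f y‖ = ‖y‖) y
    (isClosed_eq (by fun_prop) (by fun_prop)) fun x => ?_
  rw [hL, hfg]

/-- Two families with the same Gram matrix and dense spans are related by a unitary operator. -/
theorem exists_unitary_of_gram_eq [CompleteSpace E] [CompleteSpace E'] {ι : Type*} (x : ι → E)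
    (y : ι → E') (hxy : ∀ i j, ⟪x i, x j⟫_ℂ = ⟪y i, y j⟫_ℂ)
    (hx : Dense (Submodule.span ℂ (Set.range x) : Set E))
    (hy : Dense (Submodule.span ℂ (Set.range y) : Set E')) :
    ∃ U : E ≃ₗᵢ[ℂ] E', ∀ i, U (x i) = y i := by
  have hd : ∀ {F : Type _} [NormedAddCommGroup F] [InnerProductSpace ℂ F] (x : ι → F),
      Dense (Submodule.span ℂ (Set.range x) : Set F) →
      DenseRange (Finsupp.linearCombination ℂ x) := fun x hx => by
    rwa [← Finsupp.range_linearCombination, LinearMap.coe_range] at hx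
  have hd' : DenseRange (Finsupp.linearCombination ℂ y) := by
    rwa [← Finsupp.range_linearCombination, LinearMap.coe_range] at hy
  have hn : ∀ c : ι →₀ ℂ, ‖Finsupp.linearCombination ℂ y c‖ = ‖Finsupp.linearCombination ℂ x c‖ :=
    fun c => by
      have : ⟪Finsupp.linearCombination ℂ y c, Finsupp.linearCombination ℂ y c⟫_ℂ =
          ⟪Finsupp.linearCombination ℂ x c, Finsupp.linearCombination ℂ x c⟫_ℂ := by
        simp only [Finsupp.linearCombination_apply, Finsupp.sum, sum_inner, inner_sum,
          inner_smul_left, inner_smul_right, hxy]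
      rw [inner_self_eq_norm_sq_to_K, inner_self_eq_norm_sq_to_K] at this
      norm_cast at this
      exact (sq_eq_sq₀ (norm_nonneg _) (norm_nonneg _)).1 this
  obtain ⟨L, hL⟩ := exists_isometry_of_norm_eq _ _ hn (hd x hx)
  have hLs : Function.Surjective L := by
    have hcl : IsClosed (Set.range L) := L.isometry.isClosedEmbedding.isClosed_range
    have hsub : Set.range (Finsupp.linearCombination ℂ y) ⊆ Set.range L := by
      rintro _ ⟨c, rfl⟩
      exact ⟨_, hL c⟩
    rw [← Set.range_eq_univ, ← hcl.closure_eq]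
    exact (hd'.mono hsub).closure_eq
  refine ⟨LinearIsometryEquiv.ofSurjective L hLs, fun i => ?_⟩
  simpa using hL (Finsupp.single i 1)

theorem dense_of_orthogonal_eq_zero [CompleteSpace E] {N : Submodule ℂ E}
    (h : ∀ x, (∀ y ∈ N, ⟪y, x⟫_ℂ = 0) → x = 0) : Dense (N : Set E) := by
  rw [Submodule.dense_iff_topologicalClosure_eq_top, Submodule.topologicalClosure_eq_top_iff,
    Submodule.eq_bot_iff]
  exact fun x hx => h x ((Submodule.mem_orthogonal _ _).1 hx)

end Gram

namespace BiIsometry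

/-! ### The vectors generating a pure bi-isometry and their Gram matrix -/

section Model

variable {K : Type*} [NormedAddCommGroup K] [InnerProductSpace ℂ K] (W : BiIsometry K)

theorem inner_orthogonal {h r : K} (hh : h ∈ W.shiftSpace) (hr : r ∈ W.shiftSpaceᗮ) :
    ⟪h, r⟫_ℂ = 0 := (Submodule.mem_orthogonal _ _).1 hr _ hh

theorem closure_span_le {ι : Type*} {x : ι → K} {N : Submodule ℂ K} (hN : IsClosed (N : Set K))
    (h : ∀ i, x i ∈ N) : (Submodule.span ℂ (Set.range x)).topologicalClosure ≤ N :=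
  Submodule.topologicalClosure_minimal _ (Submodule.span_le.2 (Set.range_subset_iff.2 h)) hN

theorem map_mem_closure_span {ι : Type*} {x : ι → K} (T : K →L[ℂ] K)
    (h : ∀ i, T (x i) ∈ (Submodule.span ℂ (Set.range x)).topologicalClosure) :
    ∀ y ∈ (Submodule.span ℂ (Set.range x)).topologicalClosure,
      T y ∈ (Submodule.span ℂ (Set.range x)).topologicalClosure := by
  have hcl : IsClosed (((Submodule.span ℂ (Set.range x)).topologicalClosure.comap
      (T : K →ₗ[ℂ] K) : Submodule ℂ K) : Set K) :=
    (Submodule.isClosed_topologicalClosure _).preimage T.continuous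
  exact fun y hy => closure_span_le hcl h hy

variable [CompleteSpace K]

/-- The vectors `V₀ᵏ e` with `e` in the defect space. -/
def shiftFamily (i : ℕ × W.charSpace) : W.shiftSpace := (W.charShift ^ i.1) i.2

theorem dense_span_shiftFamily :
    Dense (Submodule.span ℂ (Set.range W.shiftFamily) : Set W.shiftSpace) :=
  dense_of_orthogonal_eq_zero fun x hx => W.eq_bot_of_shiftSpace x fun k e he =>
    hx _ (Submodule.subset_span ⟨(k, ⟨e, he⟩), rfl⟩)

theorem charContraction_charShift_pow (k : ℕ) (x : W.shiftSpace) :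
    W.charContraction ((W.charShift ^ k) x) = (W.charShift ^ k) (W.charContraction x) := by
  induction k with
  | zero => rfl
  | succ k ih =>
    rw [pow_succ']
    exact (W.charContraction_charShift _).trans (congrArg _ ih)

/-- The off-diagonal part `P_ℜ W₁ | ℌ` of the second isometry. -/
def offDiag : W.shiftSpace →L[ℂ] K :=
  W.W₁.toContinuousLinearMap ∘L W.shiftSpace.subtypeL - W.shiftSpace.subtypeL ∘L W.charContraction

theorem W₁_coe (h : W.shiftSpace) : W.W₁ h = (W.charContraction h : K) + W.offDiag h :=
  (add_sub_cancel _ _).symm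

theorem offDiag_mem (h : W.shiftSpace) : W.offDiag h ∈ W.shiftSpaceᗮ :=
  W.W₁_sub_charContraction_mem h

theorem W₀_offDiag (h : W.shiftSpace) : W.W₀ (W.offDiag h) = W.offDiag (W.charShift h) := by
  change W.W₀ (W.W₁ h - W.charContraction h) =
    W.W₁ (W.W₀ h) - W.charContraction (W.charShift h)
  rw [charContraction_charShift, map_sub, W.comm]
  rfl

/-- This is `D*D = I - A*A`: `W₁` is isometric and its two components on `ℌ` have orthogonal ranges.
-/
theorem inner_offDiag (h h' : W.shiftSpace) : ⟪W.offDiag h, W.offDiag h'⟫_ℂ =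
    ⟪h, h'⟫_ℂ - ⟪W.charContraction h, W.charContraction h'⟫_ℂ := by
  have h1 : ⟪W.W₁ h, W.W₁ h'⟫_ℂ = ⟪h, h'⟫_ℂ := W.W₁.inner_map_map _ _
  have h2 := W.inner_orthogonal (W.charContraction h).2 (W.offDiag_mem h')
  have h3 : ⟪W.offDiag h, W.charContraction h'⟫_ℂ = 0 := by
    rw [← inner_conj_symm, W.inner_orthogonal (W.charContraction h').2 (W.offDiag_mem h), map_zero]
  rw [W₁_coe, W₁_coe, inner_add_left, inner_add_right, inner_add_right, h2, h3] at h1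
  rw [← h1, Submodule.coe_inner]
  ring

/-- `W₁ s` is orthogonal to `W₁ h` because `s ⟂ h`, and to the `ℌ`-component of `W₁ h` because it
stays in the complement. So the range of `D` is wandering for `W₁`. -/
theorem inner_W₁_offDiag {s : K} (hs : s ∈ W.shiftSpaceᗮ) (h : W.shiftSpace) :
    ⟪W.W₁ s, W.offDiag h⟫_ℂ = 0 := by
  have h1 : ⟪W.W₁ s, W.W₁ h⟫_ℂ = 0 := by
    rw [W.W₁.inner_map_map, ← inner_conj_symm, W.inner_orthogonal h.2 hs, map_zero]
  have h2 : ⟪W.W₁ s, W.charContraction h⟫_ℂ = 0 := by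
    rw [← inner_conj_symm, W.inner_orthogonal (W.charContraction h).2 (W.W₁_mem_orthogonal hs),
      map_zero]
  rw [← h1, W₁_coe, inner_add_right, h2, zero_add]

/-- The vectors `W₁ᵐ D h`, where `D` is the off-diagonal part of `W₁`. -/
def forwardOrbit : ℕ → W.shiftSpace → K
  | 0, h => W.offDiag h
  | m + 1, h => W.W₁ (forwardOrbit m h)

theorem forwardOrbit_mem (m : ℕ) (h : W.shiftSpace) : W.forwardOrbit m h ∈ W.shiftSpaceᗮ := by
  induction m with
  | zero => exact W.offDiag_mem h
  | succ m ih => exact W.W₁_mem_orthogonal ih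

theorem W₀_forwardOrbit (m : ℕ) (h : W.shiftSpace) :
    W.W₀ (W.forwardOrbit m h) = W.forwardOrbit m (W.charShift h) := by
  induction m with
  | zero => exact W.W₀_offDiag h
  | succ m ih => exact (W.comm _).trans (congrArg _ ih)

theorem inner_forwardOrbit (m m' : ℕ) (h h' : W.shiftSpace) :
    ⟪W.forwardOrbit m h, W.forwardOrbit m' h'⟫_ℂ = if m = m' then
      ⟪h, h'⟫_ℂ - ⟪W.charContraction h, W.charContraction h'⟫_ℂ else 0 := by
  induction m generalizing m' with
  | zero =>
    cases m' with
    | zero => exact (W.inner_offDiag h h').trans (if_pos rfl).symm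
    | succ m' =>
      rw [if_neg (by omega), ← inner_conj_symm]
      exact (congrArg _ (W.inner_W₁_offDiag (W.forwardOrbit_mem m' h') h)).trans (map_zero _)
  | succ m ih =>
    cases m' with
    | zero =>
      rw [if_neg (by omega)]
      exact W.inner_W₁_offDiag (W.forwardOrbit_mem m h) h'
    | succ m' => exact (W.W₁.inner_map_map _ _).trans ((ih m').trans (by simp))

/-- The vectors `W₀*ⁿ W₁ᵐ D h`, where `D` is the off-diagonal part of `W₁`. -/
def orbit : ℕ → ℕ → W.shiftSpace → K
  | 0, m, h => W.forwardOrbit m h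
  | n + 1, m, h => W.adj₀ (orbit n m h)

theorem orbit_mem (n m : ℕ) (h : W.shiftSpace) : W.orbit n m h ∈ W.shiftSpaceᗮ := by
  induction n with
  | zero => exact W.forwardOrbit_mem m h
  | succ n ih => exact W.adj₀_mem_orthogonal ih

theorem W₀_orbit_succ (n m : ℕ) (h : W.shiftSpace) : W.W₀ (W.orbit (n + 1) m h) = W.orbit n m h :=
  W.W₀_adj₀ (W.orbit_mem n m h)

theorem W₀_orbit (n m : ℕ) (h : W.shiftSpace) :
    W.W₀ (W.orbit n m h) = W.orbit n m (W.charShift h) := by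
  induction n with
  | zero => exact W.W₀_forwardOrbit m h
  | succ n ih => rw [W₀_orbit_succ, orbit, ← ih, adj₀_W₀]

theorem W₁_orbit (n m : ℕ) (h : W.shiftSpace) : W.W₁ (W.orbit n m h) = W.orbit n (m + 1) h := by
  induction n with
  | zero => rfl
  | succ n ih => rw [orbit, W.W₁_adj₀ (W.orbit_mem n m h), ih, orbit]

/-- Applying `W₀` to both entries preserves the inner product; it removes one `W₀*` from one entry
and puts one `V₀` on the vector in the other. This reduces to the forward orbits, and the result
involves only `V₀` and `A`. -/
theorem inner_orbit (n n' m m' : ℕ) (h h' : W.shiftSpace) :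
    ⟪W.orbit n m h, W.orbit n' m' h'⟫_ℂ = if m = m' then
      ⟪(W.charShift ^ n') h, (W.charShift ^ n) h'⟫_ℂ - ⟪(W.charShift ^ n') (W.charContraction h),
        (W.charShift ^ n) (W.charContraction h')⟫_ℂ else 0 := by
  induction n generalizing h h' with
  | zero =>
    induction n' generalizing h h' with
    | zero => simpa [orbit] using W.inner_forwardOrbit m m' h h'
    | succ n' ih =>
      rw [← W.W₀.inner_map_map, W₀_orbit_succ, W₀_orbit, ih, charContraction_charShift]
      rfl
  | succ n ih =>
    rw [← W.W₀.inner_map_map, W₀_orbit_succ, W₀_orbit, ih, charContraction_charShift]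
    rfl

/-- The family of all vectors of the shift space and all vectors `W₀*ⁿ W₁ᵐ D h`. -/
def modelFamily : W.shiftSpace ⊕ ℕ × ℕ × W.shiftSpace → K
  | .inl h => h
  | .inr (n, m, h) => W.orbit n m h

theorem isReducing_of_adjoint {M : Submodule ℂ K} (hcl : IsClosed (M : Set K))
    (h₀ : ∀ x ∈ M, W.W₀ x ∈ M) (h₁ : ∀ x ∈ M, W.W₁ x ∈ M)
    (h₀' : ∀ x ∈ M, W.adj₀ x ∈ M) (h₁' : ∀ x ∈ M, W.adj₁ x ∈ M) : W.IsReducing M where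
  isClosed := hcl
  inv₀ := h₀
  inv₁ := h₁
  orth_inv₀ x hx := (Submodule.mem_orthogonal _ _).2 fun y hy => by
    rw [← adj₀_inner]
    exact (Submodule.mem_orthogonal _ _).1 hx _ (h₀' y hy)
  orth_inv₁ x hx := (Submodule.mem_orthogonal _ _).2 fun y hy => by
    rw [← adj₁_inner]
    exact (Submodule.mem_orthogonal _ _).1 hx _ (h₁' y hy)

theorem mem_of_forall_orthogonal {M : Submodule ℂ K} (hcl : IsClosed (M : Set K)) {x : K}
    (h : ∀ y ∈ Mᗮ, ⟪x, y⟫_ℂ = 0) : x ∈ M := by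
  rw [← hcl.submodule_topologicalClosure_eq, ← Submodule.orthogonal_orthogonal_eq_closure]
  exact (Submodule.mem_orthogonal' _ _).2 h

variable {W} in
theorem IsReducing.adj₀_mem {M : Submodule ℂ K} (h : W.IsReducing M) {x : K} (hx : x ∈ M) :
    W.adj₀ x ∈ M := mem_of_forall_orthogonal h.isClosed fun y hy => by
  rw [adj₀_inner]
  exact (Submodule.mem_orthogonal _ _).1 (h.orth_inv₀ y hy) _ hx

variable {W} in
theorem IsReducing.orthogonal {M : Submodule ℂ K} (h : W.IsReducing M) : W.IsReducing Mᗮ where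
  isClosed := Submodule.isClosed_orthogonal _
  inv₀ := h.orth_inv₀
  inv₁ := h.orth_inv₁
  orth_inv₀ x hx := by
    rw [Submodule.orthogonal_orthogonal_eq_closure, h.isClosed.submodule_topologicalClosure_eq] at *
    exact h.inv₀ x hx
  orth_inv₁ x hx := by
    rw [Submodule.orthogonal_orthogonal_eq_closure, h.isClosed.submodule_topologicalClosure_eq] at *
    exact h.inv₁ x hx

/-- Both isometries and both adjoints map generators into the closed span. Only `W₁*` on the vectors
with `m = 0` leaves the orbits, and there it lands in the shift space. -/
theorem isReducing_closure_span_modelFamily :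
    W.IsReducing (Submodule.span ℂ (Set.range W.modelFamily)).topologicalClosure := by
  set N := (Submodule.span ℂ (Set.range W.modelFamily)).topologicalClosure with hN
  have hmem : ∀ i, W.modelFamily i ∈ N := fun i =>
    Submodule.le_topologicalClosure _ (Submodule.subset_span ⟨i, rfl⟩)
  have hl : ∀ h ∈ W.shiftSpace, h ∈ N := fun h hh => hmem (.inl ⟨h, hh⟩)
  have hr : ∀ n m h, W.orbit n m h ∈ N := fun n m h => hmem (.inr (n, m, h))
  refine W.isReducing_of_adjoint (Submodule.isClosed_topologicalClosure _)
    (map_mem_closure_span W.W₀.toContinuousLinearMap ?_)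
    (map_mem_closure_span W.W₁.toContinuousLinearMap ?_)
    (map_mem_closure_span W.adj₀ ?_) (map_mem_closure_span W.adj₁ ?_)
  · rintro (h | ⟨n, m, h⟩)
    · exact hl _ (W.map_mem_shiftSpace _ h.2)
    · change W.W₀ (W.orbit n m h) ∈ N
      rw [W₀_orbit]
      exact hr _ _ _
  · rintro (h | ⟨n, m, h⟩)
    · change W.W₁ h ∈ N
      rw [W₁_coe]
      exact add_mem (hl _ (Subtype.coe_prop _)) (hr 0 0 h)
    · change W.W₁ (W.orbit n m h) ∈ N
      rw [W₁_orbit]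
      exact hr _ _ _
  · rintro (h | ⟨n, m, h⟩)
    · exact hl _ (W.adj₀_mem_shiftSpace h.2)
    · exact hr (n + 1) m h
  · rintro (h | ⟨n, m, h⟩)
    · exact hl _ (W.adj₁_mem_shiftSpace h.2)
    · change W.adj₁ (W.orbit n m h) ∈ N
      cases m with
      | zero =>
        refine hl _ ?_
        induction n with
        | zero =>
          -- `W₁* D h = h - W₁* A h`, and `W₁*` preserves the shift space.
          change W.adj₁ (W.W₁ h - W.charContraction h) ∈ W.shiftSpace
          rw [map_sub, adj₁_W₁]
          exact sub_mem h.2 (W.adj₁_mem_shiftSpace (Subtype.coe_prop _))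
        | succ n ih =>
          rw [orbit, adj₁_adj₀]
          exact W.adj₀_mem_shiftSpace ih
      | succ m =>
        rw [← W₁_orbit, adj₁_W₁]
        exact hr _ _ _

/-- The orthogonal complement of the span is reducing and lies in `ℜ`, where `W₀` has inverse `W₀*`;
purity forces it to vanish. -/
theorem IsZeroPure.dense_span_modelFamily (hW : W.IsZeroPure) :
    Dense (Submodule.span ℂ (Set.range W.modelFamily) : Set K) := by
  have hred := W.isReducing_closure_span_modelFamily
  have hle : W.shiftSpace ≤ (Submodule.span ℂ (Set.range W.modelFamily)).topologicalClosure :=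
    fun h hh => Submodule.le_topologicalClosure _ (Submodule.subset_span ⟨.inl ⟨h, hh⟩, rfl⟩)
  rw [Submodule.dense_iff_topologicalClosure_eq_top, ← hred.isClosed.submodule_topologicalClosure_eq,
    Submodule.topologicalClosure_eq_top_iff]
  exact hW _ hred.orthogonal fun y hy => ⟨W.adj₀ y, hred.orthogonal.adj₀_mem hy,
    W.W₀_adj₀ (Submodule.orthogonal_le hle hy)⟩

end Model

/-! ### Completeness of the invariant -/

section Completeness

variable {K : Type*} [NormedAddCommGroup K] [InnerProductSpace ℂ K] [CompleteSpace K]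
  {K' : Type*} [NormedAddCommGroup K'] [InnerProductSpace ℂ K'] [CompleteSpace K']

/-- Equivalent characteristic functions have equivalent characteristic pairs. -/
theorem exists_pair_equiv {W : BiIsometry K} {W' : BiIsometry K'}
    (h : FunctionsUnitarilyEquivalent W.charFunction W'.charFunction) :
    ∃ Φ : W.shiftSpace ≃ₗᵢ[ℂ] W'.shiftSpace, (∀ x, Φ (W.charShift x) = W'.charShift (Φ x)) ∧
      ∀ x, Φ (W.charContraction x) = W'.charContraction (Φ x) := by
  obtain ⟨u, hu⟩ := h
  obtain ⟨Φ, hΦ⟩ := exists_unitary_of_gram_eq W.shiftFamily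
    (fun i => W'.shiftFamily (i.1, u i.2))
    (fun i j => by
      simp only [shiftFamily]
      rw [inner_pow_pow_defectSpace W.norm_charShift _ _ i.2.2 j.2.2,
        inner_pow_pow_defectSpace W'.norm_charShift _ _ (u i.2).2 (u j.2).2]
      congr 1
      exact (u.inner_map_map i.2 j.2).symm) W.dense_span_shiftFamily (by
      have hs : Function.Surjective (fun i : ℕ × W.charSpace => (i.1, u i.2)) :=
        fun i => ⟨(i.1, u.symm i.2), by simp⟩
      have := hs.range_comp W'.shiftFamily
      rw [Function.comp_def] at this
      rw [this]
      exact W'.dense_span_shiftFamily)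
  have hΦ' : ∀ (k : ℕ) (e : W.charSpace),
      Φ ((W.charShift ^ k) e) = (W'.charShift ^ k) (u e) := fun k e => hΦ (k, e)
  have hV : ∀ x, Φ (W.charShift x) = W'.charShift (Φ x) := by
    have := ContinuousLinearMap.ext_on (f := (Φ : W.shiftSpace →L[ℂ] W'.shiftSpace) ∘L W.charShift)
      (g := W'.charShift ∘L (Φ : W.shiftSpace →L[ℂ] W'.shiftSpace)) W.dense_span_shiftFamily (by
        rintro _ ⟨⟨k, e⟩, rfl⟩
        change Φ (W.charShift ((W.charShift ^ k) e)) = W'.charShift (Φ ((W.charShift ^ k) e))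
        have h2 := hΦ' (k + 1) e
        rw [pow_succ', pow_succ'] at h2
        rw [hΦ']
        exact h2)
    exact fun x => congrArg (fun T : W.shiftSpace →L[ℂ] W'.shiftSpace => T x) this
  have hVpow : ∀ (k : ℕ) x, Φ ((W.charShift ^ k) x) = (W'.charShift ^ k) (Φ x) := fun k x => by
    induction k with
    | zero => rfl
    | succ k ih =>
      rw [pow_succ', pow_succ']
      exact (hV _).trans (congrArg _ ih)
  -- Tested against `V₀'ᵏ (u f)`, both sides give the `k`-th Taylor coefficient of the same scalar
  -- function `z ↦ ⟪f, Θ(z) e⟫`.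
  have hAE : ∀ e : W.charSpace, Φ (W.charContraction e) = W'.charContraction (u e) := fun e => by
    rw [← sub_eq_zero]
    refine W'.eq_bot_of_shiftSpace _ fun k f' hf' => ?_
    obtain ⟨f, hf⟩ := u.surjective ⟨f', hf'⟩
    have hcoef := coeff_unique_of_hasSum (f := fun z => ⟪f, W.charFunction z e⟫_ℂ)
      (c := fun k => ⟪(W.charShift ^ k) f, W.charContraction e⟫_ℂ)
      (d := fun k => ⟪(W'.charShift ^ k) (u f), W'.charContraction (u e)⟫_ℂ)
      (fun z hz => hasSum_inner_pairFunction (norm_le_one_of_norm W.norm_charShift) _ hz e f)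
      (fun z hz => by
        have h3 := hasSum_inner_pairFunction (norm_le_one_of_norm W'.norm_charShift)
          W'.charContraction hz (u e) (u f)
        have h4 := hu z (by simpa using hz) e
        have h5 : ⟪u f, pairFunction W'.charShift W'.charContraction z (u e)⟫_ℂ =
          ⟪f, W.charFunction z e⟫_ℂ := by
          rw [← u.inner_map_map f, h4]
          rfl
        rwa [h5] at h3)
    have h6 := congrFun hcoef k
    rw [← Φ.inner_map_map, hΦ', hf] at h6
    rw [inner_sub_right, h6, sub_self]
  have hA : ∀ x, Φ (W.charContraction x) = W'.charContraction (Φ x) := by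
    have := ContinuousLinearMap.ext_on
      (f := (Φ : W.shiftSpace →L[ℂ] W'.shiftSpace) ∘L W.charContraction)
      (g := W'.charContraction ∘L (Φ : W.shiftSpace →L[ℂ] W'.shiftSpace))
      W.dense_span_shiftFamily (by
        rintro _ ⟨⟨k, e⟩, rfl⟩
        change Φ (W.charContraction ((W.charShift ^ k) e)) =
          W'.charContraction (Φ ((W.charShift ^ k) e))
        rw [charContraction_charShift_pow, hVpow, hAE, hΦ', charContraction_charShift_pow])
    exact fun x => congrArg (fun T : W.shiftSpace →L[ℂ] W'.shiftSpace => T x) this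
  exact ⟨Φ, hV, hA⟩

theorem IsZeroPure.unitarilyEquivalent {W : BiIsometry K} {W' : BiIsometry K'}
    (hW : W.IsZeroPure) (hW' : W'.IsZeroPure)
    (h : FunctionsUnitarilyEquivalent W.charFunction W'.charFunction) :
    W.UnitarilyEquivalent W' := by
  obtain ⟨Φ, hV, hA⟩ := exists_pair_equiv h
  have hVpow : ∀ (k : ℕ) x, Φ ((W.charShift ^ k) x) = (W'.charShift ^ k) (Φ x) := fun k x => by
    induction k with
    | zero => rfl
    | succ k ih =>
      rw [pow_succ', pow_succ']
      exact (hV _).trans (congrArg _ ih)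
  let σ : W.shiftSpace ⊕ ℕ × ℕ × W.shiftSpace → W'.shiftSpace ⊕ ℕ × ℕ × W'.shiftSpace :=
    Sum.map Φ (Prod.map id (Prod.map id Φ))
  have hσ : Function.Surjective σ := Φ.surjective.sumMap
    (Function.surjective_id.prodMap (Function.surjective_id.prodMap Φ.surjective))
  obtain ⟨U, hU⟩ := exists_unitary_of_gram_eq W.modelFamily (fun i => W'.modelFamily (σ i))
    (by
      rintro (g | ⟨n, m, g⟩) (g' | ⟨n', m', g'⟩)
      · exact (Φ.inner_map_map g g').symm
      · exact (W.inner_orthogonal g.2 (W.orbit_mem _ _ _)).trans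
          (W'.inner_orthogonal (Φ g).2 (W'.orbit_mem _ _ _)).symm
      · change ⟪W.orbit n m g, (g' : K)⟫_ℂ = ⟪W'.orbit n m (Φ g), (Φ g' : K')⟫_ℂ
        rw [← inner_conj_symm, W.inner_orthogonal g'.2 (W.orbit_mem _ _ _), ← inner_conj_symm,
          W'.inner_orthogonal (Φ g').2 (W'.orbit_mem _ _ _)]
      · change ⟪W.orbit n m g, W.orbit n' m' g'⟫_ℂ =
          ⟪W'.orbit n m (Φ g), W'.orbit n' m' (Φ g')⟫_ℂ
        rw [inner_orbit, inner_orbit, ← hA, ← hA, ← hVpow, ← hVpow, ← hVpow, ← hVpow,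
          Φ.inner_map_map, Φ.inner_map_map])
    hW.dense_span_modelFamily (by
      have := hσ.range_comp W'.modelFamily
      rw [Function.comp_def] at this
      rw [this]
      exact hW'.dense_span_modelFamily)
  have hl : ∀ g : W.shiftSpace, U g = Φ g := fun g => hU (.inl g)
  have hr : ∀ n m g, U (W.orbit n m g) = W'.orbit n m (Φ g) := fun n m g => hU (.inr (n, m, g))
  refine ⟨U, fun x => ?_, fun x => ?_⟩
  · have := ContinuousLinearMap.ext_on
      (f := (U : K →L[ℂ] K') ∘L W.W₀.toContinuousLinearMap)
      (g := W'.W₀.toContinuousLinearMap ∘L (U : K →L[ℂ] K')) hW.dense_span_modelFamily (by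
        rintro _ ⟨g | ⟨n, m, g⟩, rfl⟩
        · change U (W.W₀ g) = W'.W₀ (U g)
          rw [← charShift_coe, hl, hV, hl, charShift_coe]
        · change U (W.W₀ (W.orbit n m g)) = W'.W₀ (U (W.orbit n m g))
          rw [W₀_orbit, hr, hr, hV, W₀_orbit])
    exact congrArg (fun T : K →L[ℂ] K' => T x) this
  · have := ContinuousLinearMap.ext_on
      (f := (U : K →L[ℂ] K') ∘L W.W₁.toContinuousLinearMap)
      (g := W'.W₁.toContinuousLinearMap ∘L (U : K →L[ℂ] K')) hW.dense_span_modelFamily (by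
        rintro _ ⟨g | ⟨n, m, g⟩, rfl⟩
        · change U (W.W₁ g) = W'.W₁ (U g)
          rw [W₁_coe, map_add, hl, hA, hl, W₁_coe]
          exact congrArg _ (hr 0 0 g)
        · change U (W.W₁ (W.orbit n m g)) = W'.W₁ (U (W.orbit n m g))
          rw [W₁_orbit, hr, hr, W₁_orbit])
    exact congrArg (fun T : K →L[ℂ] K' => T x) this

end Completeness

end BiIsometry

/-! ### Symmetry and transitivity of equivalence of functions -/

theorem FunctionsUnitarilyEquivalent.symm {E E' : Type*}
    [NormedAddCommGroup E] [InnerProductSpace ℂ E] [NormedAddCommGroup E'] [InnerProductSpace ℂ E']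
    {Θ : ℂ → E →L[ℂ] E} {Θ' : ℂ → E' →L[ℂ] E'} (h : FunctionsUnitarilyEquivalent Θ Θ') :
    FunctionsUnitarilyEquivalent Θ' Θ := by
  obtain ⟨U, hU⟩ := h
  refine ⟨U.symm, fun z hz x => ?_⟩
  rw [U.symm_apply_eq, hU z hz, U.apply_symm_apply]

theorem FunctionsUnitarilyEquivalent.trans {E E' E'' : Type*}
    [NormedAddCommGroup E] [InnerProductSpace ℂ E] [NormedAddCommGroup E'] [InnerProductSpace ℂ E']
    [NormedAddCommGroup E''] [InnerProductSpace ℂ E'']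
    {Θ : ℂ → E →L[ℂ] E} {Θ' : ℂ → E' →L[ℂ] E'} {Θ'' : ℂ → E'' →L[ℂ] E''}
    (h : FunctionsUnitarilyEquivalent Θ Θ') (h' : FunctionsUnitarilyEquivalent Θ' Θ'') :
    FunctionsUnitarilyEquivalent Θ Θ'' := by
  obtain ⟨U, hU⟩ := h
  obtain ⟨U', hU'⟩ := h'
  exact ⟨U.trans U', fun z hz x => (congrArg U' (hU z hz x)).trans (hU' z hz _)⟩

/-! ### The pure part, and bi-isometries extending a given pair -/

namespace BiIsometry

variable {K : Type*} [NormedAddCommGroup K] [InnerProductSpace ℂ K]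

/-- The restriction of a bi-isometry to an invariant subspace. -/
def restrict (W : BiIsometry K) (N : Submodule ℂ K) (h₀ : ∀ x ∈ N, W.W₀ x ∈ N)
    (h₁ : ∀ x ∈ N, W.W₁ x ∈ N) : BiIsometry N where
  W₀ := ⟨W.W₀.toLinearMap.restrict h₀, fun x => W.W₀.norm_map x⟩
  W₁ := ⟨W.W₁.toLinearMap.restrict h₁, fun x => W.W₁.norm_map x⟩
  comm x := Subtype.ext (W.comm x)

/-- A subspace on which `W₀` is onto is orthogonal to the shift space. -/
theorem le_shiftSpace_orthogonal (W : BiIsometry K) {M : Submodule ℂ K}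
    (hM : ∀ y ∈ M, ∃ x ∈ M, W.W₀ x = y) : M ≤ W.shiftSpaceᗮ := by
  intro y hy
  rw [mem_shiftSpace_orthogonal_iff]
  intro k e he
  induction k generalizing y with
  | zero =>
    obtain ⟨x, -, rfl⟩ := hM y hy
    rw [← inner_conj_symm]
    exact (congrArg _ (W.mem_defectSpace_W₀.1 he x)).trans (map_zero _)
  | succ k ih =>
    obtain ⟨x, hx, rfl⟩ := hM y hy
    rw [pow_succ', ← ih hx]
    exact W.W₀.inner_map_map _ _

variable [CompleteSpace K]

/-- This gives minimality: the generated subspace is the least reducing one containing the shift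
space. -/
theorem modelFamily_mem_of_isReducing {W : BiIsometry K} {P : Submodule ℂ K}
    (hP : W.IsReducing P) (hle : W.shiftSpace ≤ P) (i) : W.modelFamily i ∈ P := by
  obtain h | ⟨n, m, h⟩ := i
  · exact hle h.2
  · change W.orbit n m h ∈ P
    induction n with
    | zero =>
      change W.forwardOrbit m h ∈ P
      induction m with
      | zero => exact sub_mem (hP.inv₁ _ (hle h.2)) (hle (Subtype.coe_prop _))
      | succ m ih => exact hP.inv₁ _ ih
    | succ n ih => exact hP.adj₀_mem ih

/-- Every bi-isometry has a `{0}`-pure part with the same characteristic function. -/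
theorem exists_isZeroPure_part (W : BiIsometry K) :
    ∃ (N : Submodule ℂ K) (_ : CompleteSpace N) (X : BiIsometry N), X.IsZeroPure ∧
      FunctionsUnitarilyEquivalent X.charFunction W.charFunction := by
  obtain ⟨N, hred, hN, hmin⟩ : ∃ N : Submodule ℂ K, W.IsReducing N ∧ W.shiftSpace ≤ N ∧
      ∀ P : Submodule ℂ K, W.IsReducing P → W.shiftSpace ≤ P → N ≤ P :=
    ⟨_, W.isReducing_closure_span_modelFamily, fun h hh =>
      Submodule.le_topologicalClosure _ (Submodule.subset_span ⟨.inl ⟨h, hh⟩, rfl⟩),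
      fun P hP hle => closure_span_le hP.isClosed (modelFamily_mem_of_isReducing hP hle)⟩
  have hc : CompleteSpace N := hred.isClosed.completeSpace_coe
  let X := W.restrict N hred.inv₀ hred.inv₁
  have hX₀ : ∀ x, ((X.W₀ x : N) : K) = W.W₀ x := fun _ => rfl
  have hX₁ : ∀ x, ((X.W₁ x : N) : K) = W.W₁ x := fun _ => rfl
  refine ⟨N, hc, X, fun M hM hsurj => ?_, ?_⟩
  · have hmapN : M.map N.subtype ≤ N := Submodule.map_subtype_le _ _
    have hort : ∀ x : N, (x : K) ∈ (M.map N.subtype)ᗮ ↔ x ∈ Mᗮ := fun x => by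
      simp only [Submodule.mem_orthogonal, Submodule.mem_map]
      exact ⟨fun h y hy => h y ⟨y, hy, rfl⟩, by rintro h _ ⟨y, hy, rfl⟩; exact h y hy⟩
    -- The complement of `M` in the whole space is its complement in `N` plus `Nᗮ`, so invariance is
    -- checked on the two pieces.
    have hdec : ∀ (T : K →ₗᵢ[ℂ] K), (∀ x ∈ Nᗮ, T x ∈ Nᗮ) → (∀ x : N, (x : K) ∈ (M.map N.subtype)ᗮ →
        T x ∈ (M.map N.subtype)ᗮ) → ∀ x ∈ (M.map N.subtype)ᗮ, T x ∈ (M.map N.subtype)ᗮ := by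
      intro T h1 h2 x hx
      obtain ⟨a, ha, b, hb, rfl⟩ := N.exists_add_mem_mem_orthogonal x
      have hb' := Submodule.orthogonal_le hmapN hb
      have ha' : a ∈ (M.map N.subtype)ᗮ := by simpa using sub_mem hx hb'
      rw [map_add]
      exact add_mem (h2 ⟨a, ha⟩ ha') (Submodule.orthogonal_le hmapN (h1 b hb))
    have hred' : W.IsReducing (M.map N.subtype) :=
      { isClosed := by
          have := hred.isClosed.isClosedEmbedding_subtypeVal.isClosedMap _ hM.isClosed
          rw [Submodule.map_coe]
          exact this
        inv₀ := by
          rintro _ ⟨x, hx, rfl⟩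
          exact ⟨_, hM.inv₀ x hx, rfl⟩
        inv₁ := by
          rintro _ ⟨x, hx, rfl⟩
          exact ⟨_, hM.inv₁ x hx, rfl⟩
        orth_inv₀ := hdec _ hred.orth_inv₀ fun x hx => by
          rw [← hX₀, hort]
          exact hM.orth_inv₀ x ((hort x).1 hx)
        orth_inv₁ := hdec _ hred.orth_inv₁ fun x hx => by
          rw [← hX₁, hort]
          exact hM.orth_inv₁ x ((hort x).1 hx) }
    have hle : M.map N.subtype ≤ W.shiftSpaceᗮ := W.le_shiftSpace_orthogonal (by
      rintro _ ⟨y, hy, rfl⟩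
      obtain ⟨x, hx, rfl⟩ := hsurj y hy
      exact ⟨_, ⟨x, hx, rfl⟩, rfl⟩)
    have hle' : W.shiftSpace ≤ (M.map N.subtype)ᗮ :=
      (Submodule.le_orthogonal_orthogonal _).trans (Submodule.orthogonal_le hle)
    -- The complement of `M` is reducing and contains the shift space, so minimality puts `N`, and
    -- with it `M`, inside that complement; hence `M = 0`.
    have hNM := hmin _ hred'.orthogonal hle'
    rw [Submodule.eq_bot_iff]
    intro x hx
    have := (hort x).1 (hNM x.2)
    exact Submodule.disjoint_def.1 M.orthogonal_disjoint _ hx this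
  · have hdef : ∀ x : N, x ∈ defectSpace X.W₀.toContinuousLinearMap ↔
        (x : K) ∈ defectSpace W.W₀.toContinuousLinearMap := fun x => by
      rw [mem_defectSpace_W₀, mem_defectSpace_W₀]
      refine ⟨fun h y => ?_, fun h y => h y⟩
      obtain ⟨a, ha, b, hb, rfl⟩ := N.exists_add_mem_mem_orthogonal y
      rw [map_add, inner_add_left,
        (Submodule.mem_orthogonal' _ _).1 (hred.orth_inv₀ _ hb) _ x.2, add_zero]
      exact h ⟨a, ha⟩
    refine functionsUnitarilyEquivalent_of_intertwine X W N.subtypeₗᵢ (fun _ => rfl)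
      (fun e he => (hdef e).1 he)
      (fun e he => ⟨⟨e, hN (W.defect_mem_shiftSpace he)⟩, (hdef _).2 he, rfl⟩) fun x => ?_
    -- This inclusion alone suffices: a vector orthogonal to the image of the shift space of `X` is
    -- then orthogonal to that of `W`.
    have hs : W.shiftSpace ≤ X.shiftSpace.map N.subtype := by
      refine W.shiftSpace_le_of_invariant ?_ (fun e he => ?_) ?_
      · have := hred.isClosed.isClosedEmbedding_subtypeVal.isClosedMap _
          (Submodule.isClosed_topologicalClosure _ : IsClosed (X.shiftSpace : Set N))
        rw [Submodule.map_coe]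
        exact this
      · exact ⟨⟨e, hN (W.defect_mem_shiftSpace he)⟩,
          X.defect_mem_shiftSpace ((hdef _).2 he), rfl⟩
      · rintro _ ⟨x, hx, rfl⟩
        exact ⟨_, X.map_mem_shiftSpace x hx, rfl⟩
    refine (Submodule.mem_orthogonal _ _).2 fun y hy => ?_
    obtain ⟨y', hy', rfl⟩ := hs hy
    exact (Submodule.mem_orthogonal _ _).1 (X.W₁_sub_charContraction_mem x) y' hy'

/-- A bi-isometry extending a shift pair `(V, A)` whose first entry is unitary on the complement
has the operator function of `(V, A)` as characteristic function. -/
theorem functionsUnitarilyEquivalent_pairFunction (W : BiIsometry K) {H : Type*}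
    [NormedAddCommGroup H] [InnerProductSpace ℂ H] [CompleteSpace H] {V A : H →L[ℂ] H}
    (ι : H →ₗᵢ[ℂ] K) (hV : ∀ x, W.W₀ (ι x) = ι (V x))
    (hr : ∀ r, (∀ x, ⟪ι x, r⟫_ℂ = 0) → ∃ s, (∀ x, ⟪ι x, s⟫_ℂ = 0) ∧ W.W₀ s = r)
    (hr' : ∀ s, (∀ x, ⟪ι x, s⟫_ℂ = 0) → ∀ x, ⟪ι x, W.W₀ s⟫_ℂ = 0)
    (hA : ∀ x y, ⟪ι y, W.W₁ (ι x) - ι (A x)⟫_ℂ = 0)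
    (hpure : ∀ x, (∀ (k : ℕ), ∀ e ∈ defectSpace V, ⟪(V ^ k) e, x⟫_ℂ = 0) → x = 0) :
    FunctionsUnitarilyEquivalent (pairFunction V A) W.charFunction := by
  have hVn : ∀ x, ‖V x‖ = ‖x‖ := fun x => by
    rw [← ι.norm_map, ← hV, W.W₀.norm_map, ι.norm_map]
  have hdec : ∀ y, ∃ h r, (∀ x, ⟪ι x, r⟫_ℂ = 0) ∧ y = ι h + r := fun y => by
    have hc : CompleteSpace (LinearMap.range ι.toLinearMap) :=
      ι.isometry.isUniformInducing.isComplete_range.completeSpace_coe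
    obtain ⟨_, ⟨h, rfl⟩, r, hr, rfl⟩ :=
      (LinearMap.range ι.toLinearMap).exists_add_mem_mem_orthogonal y
    exact ⟨h, r, fun x => (Submodule.mem_orthogonal _ _).1 hr _ ⟨x, rfl⟩, rfl⟩
  have hE : ∀ e ∈ defectSpace V, ι e ∈ defectSpace W.W₀.toContinuousLinearMap := fun e he =>
    W.mem_defectSpace_W₀.2 fun y => by
      obtain ⟨h, r, hr, rfl⟩ := hdec y
      rw [map_add, inner_add_left, hV, ι.inner_map_map, mem_defectSpace_iff.1 he,
        ← inner_conj_symm, hr' r hr, map_zero, add_zero]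
  have hE' : ∀ e' ∈ defectSpace W.W₀.toContinuousLinearMap, ∃ e ∈ defectSpace V, ι e = e' := by
    intro e' he'
    obtain ⟨h, r, hro, rfl⟩ := hdec e'
    obtain ⟨s, hs, rfl⟩ := hr r hro
    -- The defect vector `ι h + W₀ s` is orthogonal to `W₀ s`, and so is `ι h`.
    have h0 : W.W₀ s = 0 := by
      have := W.mem_defectSpace_W₀.1 he' s
      rw [inner_add_right, ← inner_conj_symm, hro, map_zero, zero_add] at this
      exact inner_self_eq_zero.1 this
    rw [h0, add_zero] at he' ⊢
    exact ⟨h, mem_defectSpace_iff.2 fun x => by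
      rw [← ι.inner_map_map, ← hV, W.mem_defectSpace_W₀.1 he'], rfl⟩
  have hVk : ∀ (k : ℕ) x, ι ((V ^ k) x) = (W.W₀.toContinuousLinearMap ^ k) (ι x) := fun k x => by
    induction k with
    | zero => rfl
    | succ k ih =>
      rw [pow_succ', pow_succ']
      exact (hV _).symm.trans (congrArg W.W₀ ih)
  have hsub : ∀ x ∈ W.shiftSpace, ∃ h, ι h = x := fun x hx => by
    have hcl : IsClosed (LinearMap.range ι.toLinearMap : Set K) := by
      rw [LinearMap.coe_range]
      exact ι.isometry.isClosedEmbedding.isClosed_range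
    refine W.shiftSpace_le hcl (fun k e he => ?_) hx
    obtain ⟨e, -, rfl⟩ := hE' e he
    exact ⟨_, hVk k e⟩
  have hmem : ∀ x, ι x ∈ W.shiftSpace := fun x => W.mem_shiftSpace_of_forall fun r hro => by
    obtain ⟨h, s, hs, rfl⟩ := hdec r
    -- A vector `ι h + s` orthogonal to the shift space has `h` orthogonal to every `Vᵏ e`, so
    -- `hpure` kills `h`.
    have : h = 0 := hpure h fun k e he => by
      have := W.mem_shiftSpace_orthogonal_iff.1 hro k _ (hE e he)
      rwa [← hVk, inner_add_right, hs, add_zero, ι.inner_map_map] at this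
    rw [this, map_zero, zero_add, hs]
  let T : H →L[ℂ] W.shiftSpace := ι.toContinuousLinearMap.codRestrict _ hmem
  have hT : ∀ x, ((T x : W.shiftSpace) : K) = ι x := fun _ => rfl
  have hTE : ∀ e ∈ defectSpace V, T e ∈ W.charSpace := fun e he =>
    W.mem_charSpace_iff.2 (hE e he)
  let J : defectSpace V →ₗᵢ[ℂ] W.charSpace :=
    { toFun := fun e => ⟨T e, hTE e e.2⟩
      map_add' := fun x y => Subtype.ext (map_add T _ _)
      map_smul' := fun c x => Subtype.ext (map_smul T _ _)
      norm_map' := fun x => ι.norm_map _ }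
  have hJ : Function.Surjective J := fun e' => by
    obtain ⟨e, he, h⟩ := hE' _ (W.mem_charSpace_iff.1 e'.2)
    exact ⟨⟨e, he⟩, Subtype.ext (Subtype.ext h)⟩
  refine ⟨LinearIsometryEquiv.ofSurjective J hJ, fun z hz x => ?_⟩
  refine pairFunction_intertwine (A' := W.charContraction) hVn W.norm_charShift T
    (fun x => Subtype.ext (hV x).symm) hTE (fun x => Subtype.ext ?_) (by simpa using hz) x
  refine (W.charContraction_coe_eq (hmem _) ((Submodule.mem_orthogonal _ _).2 fun y hy => ?_)).symm
  obtain ⟨h, rfl⟩ := hsub y hy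
  exact hA x h

end BiIsometry

/-! ### Discrete Parseval and contractivity of the Toeplitz operator -/

section Parseval

variable {F : Type*} [NormedAddCommGroup F] [InnerProductSpace ℂ F]

theorem sum_pow_conj_mul_eq {M : ℕ} {ζ : ℂ} (hζ : IsPrimitiveRoot ζ M) {n m : ℕ} (hn : n < M)
    (hm : m < M) :
    ∑ j ∈ Finset.range M, (starRingEnd ℂ) ((ζ ^ j) ^ n) * (ζ ^ j) ^ m =
      if n = m then (M : ℂ) else 0 := by
  have hM : M ≠ 0 := by omega
  have hz : ‖ζ‖ = 1 := hζ.norm'_eq_one hM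
  have hconj : (starRingEnd ℂ) ζ * ζ = 1 := by
    rw [mul_comm, Complex.mul_conj, Complex.normSq_eq_norm_sq, hz]
    simp
  set η := (starRingEnd ℂ) ζ ^ n * ζ ^ m with hη
  have hterm : ∀ j, (starRingEnd ℂ) ((ζ ^ j) ^ n) * (ζ ^ j) ^ m = η ^ j := fun j => by
    rw [hη, map_pow, map_pow]
    ring
  simp only [hterm]
  have hηn : ζ ^ n * η = ζ ^ m := by
    rw [hη, ← mul_assoc, ← mul_pow, mul_comm ζ, hconj, one_pow, one_mul]
  split_ifs with h
  · have : η = 1 := by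
      rw [hη, h, ← mul_pow, hconj, one_pow]
    simp [this]
  · have hne : η ≠ 1 := fun h1 => h (hζ.pow_inj hn hm (by rw [← hηn, h1, mul_one]))
    have hpow : η ^ M = 1 := by
      rw [hη, mul_pow, ← pow_mul, ← pow_mul, mul_comm n, mul_comm m, pow_mul, pow_mul, ← map_pow,
        hζ.pow_eq_one]
      simp
    have := geom_sum_mul η M
    rw [hpow, sub_self] at this
    exact (mul_eq_zero.1 this).resolve_right (sub_ne_zero.2 hne)

/-- The discrete Parseval identity for vector polynomials on the roots of unity. -/
theorem sum_norm_sq_roots_of_unity {M : ℕ} {ζ : ℂ} (hζ : IsPrimitiveRoot ζ M) (g : ℕ → F) :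
    ∑ j ∈ Finset.range M, ‖∑ n ∈ Finset.range M, (ζ ^ j) ^ n • g n‖ ^ 2 =
      M * ∑ n ∈ Finset.range M, ‖g n‖ ^ 2 := by
  have h : ∑ j ∈ Finset.range M, ⟪∑ n ∈ Finset.range M, (ζ ^ j) ^ n • g n,
      ∑ n ∈ Finset.range M, (ζ ^ j) ^ n • g n⟫_ℂ = M * ∑ n ∈ Finset.range M, ⟪g n, g n⟫_ℂ := by
    simp only [sum_inner, inner_sum, inner_smul_left, inner_smul_right]
    rw [Finset.sum_comm, Finset.mul_sum]
    refine Finset.sum_congr rfl fun n hn => ?_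
    simp only [Finset.mul_sum]
    rw [Finset.sum_comm]
    have : ∀ m ∈ Finset.range M, ∑ j ∈ Finset.range M,
        (ζ ^ j) ^ n * ((starRingEnd ℂ) ((ζ ^ j) ^ m) * ⟪g m, g n⟫_ℂ) =
        if m = n then (M : ℂ) * ⟪g m, g n⟫_ℂ else 0 := fun m hm => by
      simp only [mul_left_comm ((ζ ^ _) ^ n), ← mul_assoc]
      rw [← Finset.sum_mul, sum_pow_conj_mul_eq hζ (Finset.mem_range.1 hm) (Finset.mem_range.1 hn)]
      split_ifs <;> simp
    rw [Finset.sum_congr rfl this, Finset.sum_ite_eq' _ n, if_pos hn]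
  simp only [inner_self_eq_norm_sq_to_K] at h
  apply RCLike.ofReal_injective (K := ℂ)
  push_cast
  exact h

/-- The convolution gives the coefficients of the product of two polynomials. At each root of unity
the operator factor has norm at most `B`; summing and applying Parseval on both sides gives the
bound. -/
theorem sum_norm_sq_convolution_le (C : ℕ → F →L[ℂ] F) (f : ℕ → F) (K N : ℕ) {B : ℝ}
    (hC : ∀ ζ : ℂ, ‖ζ‖ = 1 → ‖∑ k ∈ Finset.range K, ζ ^ k • C k‖ ≤ B) :
    ∑ n ∈ Finset.range (K + N),
        ‖∑ k ∈ Finset.range K, ∑ l ∈ Finset.range N, if k + l = n then C k (f l) else 0‖ ^ 2 ≤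
      B ^ 2 * ∑ l ∈ Finset.range N, ‖f l‖ ^ 2 := by
  rcases Nat.eq_zero_or_pos (K + N) with h0 | hpos
  · obtain ⟨rfl, rfl⟩ : K = 0 ∧ N = 0 := by omega
    simp
  -- The product has degree below `K + N`, so this many roots of unity separate all its
  -- coefficients.
  set M := K + N with hM
  set g : ℕ → F := fun n => ∑ k ∈ Finset.range K, ∑ l ∈ Finset.range N,
    if k + l = n then C k (f l) else 0 with hg
  have hζ := Complex.isPrimitiveRoot_exp M hpos.ne'
  set ζ := Complex.exp (2 * Real.pi * Complex.I / M)
  have hζ1 : ‖ζ‖ = 1 := hζ.norm'_eq_one hpos.ne'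
  have hprod : ∀ w : ℂ, ∑ n ∈ Finset.range M, w ^ n • g n =
      (∑ k ∈ Finset.range K, w ^ k • C k) (∑ l ∈ Finset.range N, w ^ l • f l) := fun w => by
    simp only [hg, Finset.smul_sum, sum_apply, map_sum]
    rw [Finset.sum_comm]
    conv_rhs => rw [Finset.sum_comm]
    refine Finset.sum_congr rfl fun k hk => ?_
    rw [Finset.sum_comm]
    refine Finset.sum_congr rfl fun l hl => ?_
    have hkl : k + l ∈ Finset.range M := by
      rw [Finset.mem_range] at *
      omega
    rw [Finset.sum_eq_single_of_mem _ hkl (fun n _ hn => by rw [if_neg (Ne.symm hn), smul_zero]),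
      if_pos rfl, pow_add, mul_smul, smul_apply, map_smul]
  have hf : ∑ n ∈ Finset.range M, ‖if n < N then f n else 0‖ ^ 2 =
      ∑ l ∈ Finset.range N, ‖f l‖ ^ 2 := by
    rw [hM, add_comm, Finset.sum_range_add]
    rw [Finset.sum_congr rfl fun n hn => by rw [if_pos (Finset.mem_range.1 hn)],
      Finset.sum_eq_zero (s := Finset.range K) fun n _ => by simp, add_zero]
  have hf' : ∀ w : ℂ, ∑ n ∈ Finset.range M, w ^ n • (if n < N then f n else 0) =
      ∑ l ∈ Finset.range N, w ^ l • f l := fun w => by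
    rw [hM, add_comm, Finset.sum_range_add]
    rw [Finset.sum_congr rfl fun n hn => by rw [if_pos (Finset.mem_range.1 hn)],
      Finset.sum_eq_zero (s := Finset.range K) fun n _ => by simp, add_zero]
  have h1 := sum_norm_sq_roots_of_unity hζ g
  have h2 := sum_norm_sq_roots_of_unity hζ (fun n => if n < N then f n else 0)
  rw [hf] at h2
  simp only [hprod] at h1
  simp only [hf'] at h2
  have hMpos : (0 : ℝ) < M := by exact_mod_cast hpos
  refine le_of_mul_le_mul_left ?_ hMpos
  rw [← h1, mul_left_comm, ← h2, Finset.mul_sum]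
  refine Finset.sum_le_sum fun j _ => ?_
  rw [← mul_pow]
  refine pow_le_pow_left₀ (norm_nonneg _) ?_ 2
  refine (ContinuousLinearMap.le_opNorm _ _).trans ?_
  exact mul_le_mul_of_nonneg_right (hC _ (by rw [norm_pow, hζ1, one_pow])) (norm_nonneg _)

theorem sum_convolution_eq_antidiagonal (C : ℕ → F →L[ℂ] F) (f : ℕ → F) {K N n : ℕ} (hK : n < K)
    (hN : n < N) :
    (∑ k ∈ Finset.range K, ∑ l ∈ Finset.range N, if k + l = n then C k (f l) else 0) =
      ∑ p ∈ Finset.HasAntidiagonal.antidiagonal n, C p.1 (f p.2) := by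
  rw [← Finset.sum_product', ← Finset.sum_filter]
  congr 1
  ext ⟨k, l⟩
  simp only [Finset.mem_filter, Finset.mem_product, Finset.mem_range, Finset.HasAntidiagonal.mem_antidiagonal]
  omega

/-- The terms are bounded at a radius `ρ` with `r < ρ < 1`, which gives comparison with a geometric
series of ratio `r / ρ`. -/
theorem summable_norm_of_hasSum_ball {C : ℕ → F →L[ℂ] F} {Θ : ℂ → F →L[ℂ] F}
    (hΘ : ∀ z : ℂ, ‖z‖ < 1 → HasSum (fun n => z ^ n • C n) (Θ z)) {r : ℝ} (hr0 : 0 < r)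
    (hr1 : r < 1) : Summable fun n => r ^ n * ‖C n‖ := by
  obtain ⟨ρ, hρ, hρ1⟩ := exists_between hr1
  have hρ0 : 0 < ρ := hr0.trans hρ
  have ht := (hΘ (ρ : ℂ) (by simpa [abs_of_pos hρ0] using hρ1)).summable.tendsto_atTop_zero
  obtain ⟨M, hM⟩ := ht.norm.bddAbove_range
  have hM' : ∀ n, ρ ^ n * ‖C n‖ ≤ M := fun n => by
    have := hM ⟨n, rfl⟩
    simpa [norm_smul, abs_of_pos hρ0] using this
  refine Summable.of_nonneg_of_le (fun n => by positivity) (fun n => ?_)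
    ((summable_geometric_of_lt_one (by positivity) ((div_lt_one hρ0).2 hρ)).mul_left M)
  have : r ^ n * ‖C n‖ = (ρ ^ n * ‖C n‖) * (r / ρ) ^ n := by
    rw [div_pow]
    field_simp
  rw [this]
  exact mul_le_mul_of_nonneg_right (hM' n) (by positivity)

/-- Convolution with the Taylor coefficients of a contractive analytic function does not increase
the `ℓ²` norms of initial segments. -/
theorem sum_norm_sq_toeplitz_le [CompleteSpace F] {C : ℕ → F →L[ℂ] F} {Θ : ℂ → F →L[ℂ] F}
    (hΘ : ∀ z : ℂ, ‖z‖ < 1 → HasSum (fun n => z ^ n • C n) (Θ z))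
    (hΘ1 : ∀ z : ℂ, ‖z‖ < 1 → ‖Θ z‖ ≤ 1) (f : ℕ → F) (N : ℕ) :
    ∑ n ∈ Finset.range N, ‖∑ p ∈ Finset.HasAntidiagonal.antidiagonal n, C p.1 (f p.2)‖ ^ 2 ≤
      ∑ n ∈ Finset.range N, ‖f n‖ ^ 2 := by
  set g : ℕ → F := fun n => ∑ p ∈ Finset.HasAntidiagonal.antidiagonal n, C p.1 (f p.2) with hg
  have key : ∀ r : ℝ, 0 < r → r < 1 →
      ∑ n ∈ Finset.range N, (r ^ n * ‖g n‖) ^ 2 ≤ ∑ n ∈ Finset.range N, ‖f n‖ ^ 2 := by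
    intro r hr0 hr1
    have hsum := summable_norm_of_hasSum_ball hΘ hr0 hr1
    -- On the circle of radius `r`, the partial sum is `Θ` minus a tail, so its norm is at most `1`
    -- plus the tail; this bound tends to `1` as `K` grows.
    set B : ℕ → ℝ := fun K => 1 + ∑' k, r ^ (k + K) * ‖C (k + K)‖ with hB
    have hBlim : Tendsto (fun K => B K ^ 2 * ∑ n ∈ Finset.range N, ‖f n‖ ^ 2) atTop
        (𝓝 ((1 + 0) ^ 2 * ∑ n ∈ Finset.range N, ‖f n‖ ^ 2)) :=
      (((tendsto_sum_nat_add fun k => r ^ k * ‖C k‖).const_add 1).pow 2).mul_const _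
    rw [add_zero, one_pow, one_mul] at hBlim
    refine ge_of_tendsto hBlim ?_
    filter_upwards [eventually_ge_atTop N] with K hK
    have hbound : ∀ ζ : ℂ, ‖ζ‖ = 1 →
        ‖∑ k ∈ Finset.range K, ζ ^ k • ((r : ℂ) ^ k • C k)‖ ≤ B K := fun ζ hζ => by
      have hz : ‖ζ * r‖ < 1 := by
        rw [norm_mul, hζ, one_mul, Complex.norm_real, Real.norm_of_nonneg hr0.le]
        exact hr1
      have hs := hΘ _ hz
      have hn : ∀ k, ‖(ζ * r) ^ k • C k‖ = r ^ k * ‖C k‖ := fun k => by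
        rw [norm_smul, norm_pow, norm_mul, hζ, one_mul, Complex.norm_real,
          Real.norm_of_nonneg hr0.le]
      have h1 := hs.summable.sum_add_tsum_nat_add K
      rw [hs.tsum_eq] at h1
      have h2 : ∑ k ∈ Finset.range K, ζ ^ k • ((r : ℂ) ^ k • C k) =
          Θ (ζ * r) - ∑' k, (ζ * r) ^ (k + K) • C (k + K) := by
        rw [← h1, add_sub_cancel_right]
        exact Finset.sum_congr rfl fun k _ => by rw [smul_smul, ← mul_pow]
      rw [h2]
      refine (norm_sub_le _ _).trans (add_le_add (hΘ1 _ hz) ?_)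
      have h3 : Summable fun k => ‖(ζ * r) ^ (k + K) • C (k + K)‖ := by
        simp only [hn]
        exact (summable_nat_add_iff (f := fun k => r ^ k * ‖C k‖) K).2 hsum
      refine (norm_tsum_le_tsum_norm h3).trans_eq ?_
      simp only [hn]
    -- Weighting `f` by `rˡ` as well as `C` by `rᵏ` turns the convolution into `rⁿ g n`.
    have h := sum_norm_sq_convolution_le (fun k => (r : ℂ) ^ k • C k)
      (fun l => (r : ℂ) ^ l • f l) K N hbound
    have hle1 : ∑ l ∈ Finset.range N, ‖(r : ℂ) ^ l • f l‖ ^ 2 ≤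
        ∑ n ∈ Finset.range N, ‖f n‖ ^ 2 := Finset.sum_le_sum fun l _ => by
      refine pow_le_pow_left₀ (norm_nonneg _) ?_ 2
      rw [norm_smul, norm_pow, Complex.norm_real, Real.norm_of_nonneg hr0.le]
      exact mul_le_of_le_one_left (norm_nonneg _) (pow_le_one₀ hr0.le hr1.le)
    refine le_trans ?_ (h.trans (mul_le_mul_of_nonneg_left hle1 (sq_nonneg _)))
    refine le_trans (le_of_eq ?_) (Finset.sum_le_sum_of_subset_of_nonneg
      (Finset.range_subset_range.2 (show N ≤ K + N by omega)) fun _ _ _ => sq_nonneg _)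
    refine Finset.sum_congr rfl fun n hn => ?_
    have hn' := Finset.mem_range.1 hn
    rw [sum_convolution_eq_antidiagonal _ _ (hn'.trans_le hK) hn']
    congr 1
    have : ∑ p ∈ Finset.HasAntidiagonal.antidiagonal n, ((r : ℂ) ^ p.1 • C p.1) ((r : ℂ) ^ p.2 • f p.2) =
        (r : ℂ) ^ n • g n := by
      rw [hg, Finset.smul_sum]
      refine Finset.sum_congr rfl fun p hp => ?_
      rw [smul_apply, map_smul, smul_smul, ← pow_add, Finset.HasAntidiagonal.mem_antidiagonal.1 hp]
    rw [this, norm_smul, norm_pow, Complex.norm_real, Real.norm_of_nonneg hr0.le]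
  have hcont : Continuous fun r : ℝ => ∑ n ∈ Finset.range N, (r ^ n * ‖g n‖) ^ 2 := by fun_prop
  have hlim := (hcont.tendsto 1).mono_left (nhdsWithin_le_nhds (s := Set.Iio 1))
  simp only [one_pow, one_mul] at hlim
  refine le_of_tendsto hlim ?_
  filter_upwards [Ioo_mem_nhdsLT (zero_lt_one' ℝ)] with r hr
  exact key r hr.1 hr.2

end Parseval

/-! ### Taylor coefficients of an analytic operator function -/

theorem IsContractiveAnalytic.exists_coeff {E : Type*} [NormedAddCommGroup E]
    [InnerProductSpace ℂ E] [CompleteSpace E] {Θ : ℂ → E →L[ℂ] E} (hΘ : IsContractiveAnalytic Θ) :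
    ∃ C : ℕ → E →L[ℂ] E, ∀ z : ℂ, ‖z‖ < 1 → HasSum (fun n => z ^ n • C n) (Θ z) := by
  refine ⟨fun n => (n.factorial : ℂ)⁻¹ • iteratedDeriv n Θ 0, fun z hz => ?_⟩
  have := Complex.hasSum_taylorSeries_on_ball (hΘ.analytic.differentiableOn) (z := z)
    (by simpa using hz)
  simp only [sub_zero] at this
  exact this.congr_fun fun n => smul_comm _ _ _

theorem hasSum_inner_apply {F : Type*} [NormedAddCommGroup F] [InnerProductSpace ℂ F]
    {C : ℕ → F →L[ℂ] F} {T : F →L[ℂ] F} {z : ℂ}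
    (h : HasSum (fun n => z ^ n • C n) T) (e f : F) :
    HasSum (fun k => z ^ k * ⟪f, C k e⟫_ℂ) ⟪f, T e⟫_ℂ := by
  have h2 := (ContinuousLinearMap.apply ℂ F e).hasSum h
  have h3 := (innerSL ℂ f).hasSum h2
  refine h3.congr_fun fun k => ?_
  exact (inner_smul_right f (C k e) (z ^ k)).symm

/-! ### Square summable sequences, the shift and Toeplitz operators -/

section SquareSummable

variable {F : Type*} [NormedAddCommGroup F]

/-- Square summable sequences in a Hilbert space. -/
abbrev SeqSpace (F : Type*) [NormedAddCommGroup F] : Type _ := lp (fun _ : ℕ => F) 2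

theorem SeqSpace.hasSum_norm_sq (x : SeqSpace F) :
    HasSum (fun n => ‖x n‖ ^ 2) (‖x‖ ^ 2) := by
  have := lp.hasSum_norm (E := fun _ : ℕ => F) (p := 2) (by simp) x
  simpa using this

theorem SeqSpace.norm_sq_eq (x : SeqSpace F) :
    ‖x‖ ^ 2 = ‖x 0‖ ^ 2 + ∑' n, ‖x (n + 1)‖ ^ 2 := by
  have h := SeqSpace.hasSum_norm_sq x
  rw [← h.tsum_eq, h.summable.tsum_eq_zero_add]

theorem memℓp_two_of_sum_le {f : ℕ → F} {B : ℝ}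
    (h : ∀ N, ∑ n ∈ Finset.range N, ‖f n‖ ^ 2 ≤ B) : Memℓp f 2 := by
  refine memℓp_gen ?_
  simpa using summable_of_sum_range_le (fun n => sq_nonneg ‖f n‖) h

variable [InnerProductSpace ℂ F]
  {F' : Type*} [NormedAddCommGroup F'] [InnerProductSpace ℂ F']

/-- A linear map of sequences that does not increase the square sums of initial segments defines
a contraction of square summable sequences. -/
def SeqSpace.lift (T : (ℕ → F) →ₗ[ℂ] (ℕ → F'))
    (hT : ∀ f N, ∑ n ∈ Finset.range N, ‖T f n‖ ^ 2 ≤ ∑ n ∈ Finset.range N, ‖f n‖ ^ 2) :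
    SeqSpace F →L[ℂ] SeqSpace F' :=
  have hle : ∀ (x : SeqSpace F) (N : ℕ), ∑ n ∈ Finset.range N, ‖T x n‖ ^ 2 ≤ ‖x‖ ^ 2 := fun x N =>
    (hT x N).trans (sum_le_hasSum _ (fun _ _ => sq_nonneg _) (SeqSpace.hasSum_norm_sq x))
  LinearMap.mkContinuous
    { toFun := fun x => ⟨T x, memℓp_two_of_sum_le (hle x)⟩
      map_add' := fun x y => Subtype.ext (map_add T _ _)
      map_smul' := fun c x => Subtype.ext (map_smul T _ _) } 1 fun x => by
    rw [one_mul]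
    refine le_of_sq_le_sq ?_ (norm_nonneg _)
    exact le_of_tendsto' (SeqSpace.hasSum_norm_sq _).tendsto_sum_nat (hle x)

theorem SeqSpace.norm_lift_apply_le (T : (ℕ → F) →ₗ[ℂ] (ℕ → F')) (hT) (x : SeqSpace F) :
    ‖SeqSpace.lift T hT x‖ ≤ ‖x‖ :=
  le_of_sq_le_sq (le_of_tendsto' (SeqSpace.hasSum_norm_sq _).tendsto_sum_nat fun N =>
    (hT x N).trans (sum_le_hasSum _ (fun _ _ => sq_nonneg _) (SeqSpace.hasSum_norm_sq x)))
    (norm_nonneg _)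

/-- The right shift of sequences. -/
def seqShift (F : Type*) [AddCommGroup F] [Module ℂ F] : (ℕ → F) →ₗ[ℂ] (ℕ → F) where
  toFun f n := Nat.casesOn n 0 f
  map_add' f g := by
    funext n
    cases n <;> simp
  map_smul' c f := by
    funext n
    cases n <;> simp

/-- The unilateral shift on square summable sequences. -/
def SeqSpace.shift (F : Type*) [NormedAddCommGroup F] [InnerProductSpace ℂ F] :
    SeqSpace F →L[ℂ] SeqSpace F :=
  SeqSpace.lift (seqShift F) fun f N => by
    cases N with
    | zero => simp
    | succ N =>
      rw [Finset.sum_range_succ', Finset.sum_range_succ]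
      simp [seqShift]

@[simp]
theorem SeqSpace.shift_zero (x : SeqSpace F) : SeqSpace.shift F x 0 = 0 := rfl

@[simp]
theorem SeqSpace.shift_succ (x : SeqSpace F) (n : ℕ) : SeqSpace.shift F x (n + 1) = x n := rfl

theorem SeqSpace.norm_shift (x : SeqSpace F) : ‖SeqSpace.shift F x‖ = ‖x‖ := by
  refine (sq_eq_sq₀ (norm_nonneg _) (norm_nonneg _)).1 ?_
  rw [SeqSpace.norm_sq_eq]
  simp [(SeqSpace.hasSum_norm_sq x).tsum_eq]

theorem SeqSpace.norm_sq_single_add_shift (g : F) (x : SeqSpace F) :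
    ‖lp.single (E := fun _ : ℕ => F) 2 0 g + SeqSpace.shift F x‖ ^ 2 = ‖g‖ ^ 2 + ‖x‖ ^ 2 := by
  rw [SeqSpace.norm_sq_eq]
  simp [(SeqSpace.hasSum_norm_sq x).tsum_eq]

theorem SeqSpace.shift_single (k : ℕ) (e : F) :
    SeqSpace.shift F (lp.single (E := fun _ : ℕ => F) 2 k e) = lp.single 2 (k + 1) e := by
  ext n
  cases n with
  | zero => simp
  | succ n => simp [Pi.single_apply]

theorem SeqSpace.shift_pow_single (k : ℕ) (e : F) :
    (SeqSpace.shift F ^ k) (lp.single (E := fun _ : ℕ => F) 2 0 e) = lp.single 2 k e := by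
  induction k with
  | zero => rfl
  | succ k ih =>
    rw [pow_succ']
    exact (congrArg _ ih).trans (SeqSpace.shift_single k e)

theorem SeqSpace.single_mem_defectSpace (e : F) :
    lp.single (E := fun _ : ℕ => F) 2 0 e ∈ defectSpace (SeqSpace.shift F) :=
  mem_defectSpace_iff.2 fun x => by
    rw [lp.inner_single_right, SeqSpace.shift_zero, inner_zero_left]

theorem SeqSpace.eq_single_of_mem_defectSpace {y : SeqSpace F}
    (hy : y ∈ defectSpace (SeqSpace.shift F)) : lp.single 2 0 (y 0) = y := by
  ext n
  cases n with
  | zero => simp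
  | succ n =>
    have := mem_defectSpace_iff.1 hy (lp.single 2 n (y (n + 1)))
    rw [SeqSpace.shift_single, lp.inner_single_left] at this
    rw [inner_self_eq_zero.1 this]
    simp

theorem SeqSpace.eq_zero_of_inner_shift_pow {x : SeqSpace F}
    (h : ∀ (k : ℕ), ∀ e ∈ defectSpace (SeqSpace.shift F), ⟪(SeqSpace.shift F ^ k) e, x⟫_ℂ = 0) :
    x = 0 := by
  ext n
  have := h n _ (SeqSpace.single_mem_defectSpace (x n))
  rw [SeqSpace.shift_pow_single, lp.inner_single_left] at this
  exact inner_self_eq_zero.1 this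

/-- The coordinatewise action of an isometry. -/
def SeqSpace.diag (u : F →ₗᵢ[ℂ] F) : SeqSpace F →ₗᵢ[ℂ] SeqSpace F where
  toLinearMap := (SeqSpace.lift (LinearMap.pi fun n => u.toLinearMap ∘ₗ LinearMap.proj n)
    fun f N => by simp).toLinearMap
  norm_map' x := by
    refine (sq_eq_sq₀ (norm_nonneg _) (norm_nonneg _)).1 ?_
    rw [← (SeqSpace.hasSum_norm_sq x).tsum_eq, ← (SeqSpace.hasSum_norm_sq _).tsum_eq]
    exact tsum_congr fun n => by
      congr 1
      exact u.norm_map (x n)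

@[simp]
theorem SeqSpace.diag_apply (u : F →ₗᵢ[ℂ] F) (x : SeqSpace F) (n : ℕ) :
    SeqSpace.diag u x n = u (x n) := rfl

theorem SeqSpace.diag_surjective (u : F ≃ₗᵢ[ℂ] F) :
    Function.Surjective (SeqSpace.diag u.toLinearIsometry) := fun y => by
  refine ⟨SeqSpace.diag u.symm.toLinearIsometry y, ?_⟩
  ext n
  simp

/-- Convolution of operator coefficients with a vector sequence. -/
def seqToeplitz (C : ℕ → F →L[ℂ] F) : (ℕ → F) →ₗ[ℂ] (ℕ → F) where
  toFun f n := ∑ p ∈ Finset.HasAntidiagonal.antidiagonal n, C p.1 (f p.2)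
  map_add' f g := by
    funext n
    simp [Finset.sum_add_distrib]
  map_smul' c f := by
    funext n
    simp [Finset.smul_sum]

variable [CompleteSpace F]

/-- Every contractive analytic function is the operator function of the shift and a commuting
contraction. -/
theorem IsContractiveAnalytic.exists_toeplitz {Θ : ℂ → F →L[ℂ] F} (hΘ : IsContractiveAnalytic Θ) :
    ∃ A : SeqSpace F →L[ℂ] SeqSpace F, (∀ x, ‖A x‖ ≤ ‖x‖) ∧
      (∀ x, A (SeqSpace.shift F x) = SeqSpace.shift F (A x)) ∧
      FunctionsUnitarilyEquivalent (pairFunction (SeqSpace.shift F) A) Θ := by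
  obtain ⟨C, hC⟩ := hΘ.exists_coeff
  have hT := sum_norm_sq_toeplitz_le hC fun z hz => hΘ.contractive z (by simpa using hz)
  let A := SeqSpace.lift (seqToeplitz C) hT
  have hA : ∀ x n, A x n = ∑ p ∈ Finset.HasAntidiagonal.antidiagonal n, C p.1 (x p.2) :=
    fun _ _ => rfl
  refine ⟨A, SeqSpace.norm_lift_apply_le _ _, fun x => ?_, FunctionsUnitarilyEquivalent.symm ?_⟩
  · ext n
    cases n with
    | zero => simp [hA]
    | succ n => simp [hA, Finset.Nat.sum_antidiagonal_succ']
  · let J : F →ₗᵢ[ℂ] defectSpace (SeqSpace.shift F) :=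
      { toLinearMap := (lp.lsingle (E := fun _ : ℕ => F) 2 0).codRestrict _
          SeqSpace.single_mem_defectSpace
        norm_map' := fun x => lp.norm_single (E := fun _ : ℕ => F) two_pos 0 x }
    have hJs : ∀ x, (J x : SeqSpace F) = lp.single 2 0 x := fun _ => rfl
    have hJ : Function.Surjective J := fun y =>
      ⟨_, Subtype.ext (SeqSpace.eq_single_of_mem_defectSpace y.2)⟩
    refine ⟨LinearIsometryEquiv.ofSurjective J hJ, fun z hz e => ?_⟩
    have hz' : ‖z‖ < 1 := by simpa using hz
    refine ext_inner_left ℂ fun y => ?_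
    obtain ⟨f, rfl⟩ := hJ y
    -- `A` sends the sequence `(e, 0, 0, …)` to `(C 0 e, C 1 e, …)`, and `Vᵏ` applied to `(f, 0, …)`
    -- reads off coordinate `k`.
    have hinner : ∀ k, ⟪(SeqSpace.shift F ^ k) (J f : SeqSpace F), A (J e : SeqSpace F)⟫_ℂ =
        ⟪f, C k e⟫_ℂ := fun k => by
      rw [hJs, hJs, SeqSpace.shift_pow_single, lp.inner_single_left, hA,
        Finset.sum_eq_single_of_mem (k, 0) (by simp)]
      · rw [lp.single_apply_self]
      · rintro ⟨i, j⟩ hij hne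
        rw [lp.single_apply_ne, map_zero]
        rintro rfl
        simp only [Finset.HasAntidiagonal.mem_antidiagonal, add_zero] at hij
        exact hne (by rw [hij])
    have hS : ‖SeqSpace.shift F‖ ≤ 1 := norm_le_one_of_norm (V := SeqSpace.shift F)
      fun x => SeqSpace.norm_shift x
    have h1 := hasSum_inner_pairFunction hS A hz' (J e) (J f)
    simp only [hinner] at h1
    have h3 := hasSum_inner_apply (hC z hz') e f
    exact (J.inner_map_map f (Θ z e)).trans (h3.unique h1)

end SquareSummable

/-! ### Unitary extension of an isometry and the defect operator -/

section Dilation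

/-- Every isometry extends to a unitary operator on the double of the space. -/
theorem LinearIsometry.exists_unitary_extension {R : Type*} [NormedAddCommGroup R]
    [InnerProductSpace ℂ R] [CompleteSpace R] (Q : R →ₗᵢ[ℂ] R) :
    ∃ U : WithLp 2 (R × R) ≃ₗᵢ[ℂ] WithLp 2 (R × R),
      ∀ a, U (WithLp.toLp 2 (a, 0)) = WithLp.toLp 2 (Q a, 0) := by
  set S : R →L[ℂ] R := Q.toContinuousLinearMap.adjoint with hS
  have hSQ : ∀ x, S (Q x) = x :=
    adjoint_apply_of_norm (V := Q.toContinuousLinearMap) fun x => Q.norm_map x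
  have hin : ∀ x y, ⟪Q x, y⟫_ℂ = ⟪x, S y⟫_ℂ := fun x y =>
    (ContinuousLinearMap.adjoint_inner_right Q.toContinuousLinearMap x y).symm
  have hort : ∀ a b, ⟪Q a, b - Q (S b)⟫_ℂ = 0 := fun a b => by
    rw [hin, map_sub, hSQ, sub_self, inner_zero_right]
  have hpyth : ∀ a y : R, ⟪Q a, y⟫_ℂ = 0 → ‖Q a + y‖ ^ 2 = ‖a‖ ^ 2 + ‖y‖ ^ 2 := fun a y h => by
    rw [sq, norm_add_sq_eq_norm_sq_add_norm_sq_of_inner_eq_zero _ _ h, Q.norm_map, sq, sq]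
  -- The block matrix with rows `(Q, I - Q Q*)` and `(0, Q*)`; it is isometric because the range of
  -- `Q` is orthogonal to that of `I - Q Q*`.
  let L : WithLp 2 (R × R) →ₗᵢ[ℂ] WithLp 2 (R × R) :=
    { toFun := fun x => WithLp.toLp 2 (Q x.fst + (x.snd - Q (S x.snd)), S x.snd)
      map_add' := fun x y => by
        apply (WithLp.equiv 2 _).injective
        ext
        · simp
          abel
        · simp
      map_smul' := fun c x => by
        apply (WithLp.equiv 2 _).injective
        ext <;> simp [smul_add, smul_sub]
      norm_map' := fun x => by
        refine (sq_eq_sq₀ (norm_nonneg _) (norm_nonneg _)).1 ?_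
        change ‖WithLp.toLp 2 (Q x.fst + (x.snd - Q (S x.snd)), S x.snd)‖ ^ 2 = ‖x‖ ^ 2
        rw [WithLp.prod_norm_sq_eq_of_L2, WithLp.prod_norm_sq_eq_of_L2]
        change ‖Q x.fst + (x.snd - Q (S x.snd))‖ ^ 2 + ‖S x.snd‖ ^ 2 = _
        rw [hpyth _ _ (hort _ _)]
        have := hpyth (S x.snd) (x.snd - Q (S x.snd)) (hort _ _)
        rw [add_sub_cancel] at this
        rw [this]
        ring }
  have hL : ∀ x, L x = WithLp.toLp 2 (Q x.fst + (x.snd - Q (S x.snd)), S x.snd) := fun _ => rfl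
  have hsurj : Function.Surjective L := fun y => by
    -- The preimage is given by the adjoint block matrix.
    refine ⟨WithLp.toLp 2 (S y.fst, y.fst - Q (S y.fst) + Q y.snd), ?_⟩
    rw [hL]
    apply (WithLp.equiv 2 _).injective
    ext
    · simp [hSQ]
    · simp [hSQ]
  refine ⟨LinearIsometryEquiv.ofSurjective L hsurj, fun a => ?_⟩
  change L _ = _
  rw [hL]
  simp

variable {H : Type u} [NormedAddCommGroup H] [InnerProductSpace ℂ H] [CompleteSpace H]

/-- A contraction has a defect operator `D` with `‖A h‖² + ‖D h‖² = ‖h‖²`. -/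
theorem exists_defect_operator {A : H →L[ℂ] H} (hA : ∀ x, ‖A x‖ ≤ ‖x‖) :
    ∃ D : H →L[ℂ] H, ∀ x, ‖A x‖ ^ 2 + ‖D x‖ ^ 2 = ‖x‖ ^ 2 := by
  have hin : ∀ x, ⟪(1 - A.adjoint * A) x, x⟫_ℂ = ((‖x‖ ^ 2 - ‖A x‖ ^ 2 : ℝ) : ℂ) := fun x => by
    change ⟪x - A.adjoint (A x), x⟫_ℂ = _
    rw [inner_sub_left, ContinuousLinearMap.adjoint_inner_left, inner_self_eq_norm_sq_to_K,
      inner_self_eq_norm_sq_to_K]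
    push_cast
    rfl
  have hpos : 0 ≤ 1 - A.adjoint * A := by
    rw [ContinuousLinearMap.nonneg_iff_isPositive, ContinuousLinearMap.isPositive_iff_complex]
    intro x
    rw [hin]
    exact ⟨congrArg Complex.ofReal (Complex.ofReal_re _),
      (sub_nonneg.2 (pow_le_pow_left₀ (norm_nonneg _) (hA x) 2)).trans_eq
        (Complex.ofReal_re _).symm⟩
  refine ⟨CFC.sqrt (1 - A.adjoint * A), fun x => ?_⟩
  have hsa : (CFC.sqrt (1 - A.adjoint * A)).IsPositive :=
    (ContinuousLinearMap.nonneg_iff_isPositive _).1 (CFC.sqrt_nonneg _)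
  have h1 : ⟪CFC.sqrt (1 - A.adjoint * A) x, CFC.sqrt (1 - A.adjoint * A) x⟫_ℂ =
      ((‖x‖ ^ 2 - ‖A x‖ ^ 2 : ℝ) : ℂ) := by
    rw [← hin, ← hsa.inner_left_eq_inner_right]
    exact congrArg (fun T : H →L[ℂ] H => ⟪T x, x⟫_ℂ) (CFC.sqrt_mul_sqrt_self _ hpos)
  rw [inner_self_eq_norm_sq_to_K] at h1
  have h2 : ‖CFC.sqrt (1 - A.adjoint * A) x‖ ^ 2 = ‖x‖ ^ 2 - ‖A x‖ ^ 2 := by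
    apply RCLike.ofReal_injective (K := ℂ)
    push_cast at h1 ⊢
    exact h1
  rw [h2]
  ring

/-- A contraction commuting with an isometry has a defect operator intertwining the isometry with
a unitary operator. -/
theorem exists_defect_unitary {V A : H →L[ℂ] H} (hV : ∀ x, ‖V x‖ = ‖x‖) (hA : ∀ x, ‖A x‖ ≤ ‖x‖)
    (hAV : ∀ x, A (V x) = V (A x)) :
    ∃ (G : Type u) (_ : NormedAddCommGroup G) (_ : InnerProductSpace ℂ G) (_ : CompleteSpace G)
      (U : G ≃ₗᵢ[ℂ] G) (D : H →L[ℂ] G), (∀ x, ‖A x‖ ^ 2 + ‖D x‖ ^ 2 = ‖x‖ ^ 2) ∧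
        ∀ x, U (D x) = D (V x) := by
  obtain ⟨D, hD⟩ := exists_defect_operator hA
  let R := (LinearMap.range (D : H →ₗ[ℂ] H)).topologicalClosure
  have hR : CompleteSpace R := (Submodule.isClosed_topologicalClosure _).completeSpace_coe
  let D₁ : H →L[ℂ] R := D.codRestrict R fun x =>
    Submodule.le_topologicalClosure _ ⟨x, rfl⟩
  have hn : ∀ x, ‖D₁ x‖ = ‖D x‖ := fun _ => rfl
  have hdense : DenseRange D₁ := by
    intro y
    rw [closure_subtype, ← Set.range_comp]
    exact y.2
  -- `D x ↦ D (V x)` preserves norms because `‖A V x‖ = ‖V A x‖ = ‖A x‖` and `‖V x‖ = ‖x‖`.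
  obtain ⟨Q, hQ⟩ := exists_isometry_of_norm_eq (D₁ : H →ₗ[ℂ] R) ((D₁ ∘L V : H →L[ℂ] R) : H →ₗ[ℂ] R)
    (fun x => by
      change ‖D (V x)‖ = ‖D x‖
      have h1 := hD x
      have h2 := hD (V x)
      rw [hAV, hV, hV] at h2
      refine (sq_eq_sq₀ (norm_nonneg _) (norm_nonneg _)).1 ?_
      linarith) hdense
  obtain ⟨U, hU⟩ := Q.exists_unitary_extension
  refine ⟨WithLp 2 (R × R), inferInstance, inferInstance, inferInstance, U,
    (BiIsometry.sumInl R R).toContinuousLinearMap ∘L D₁, fun x => ?_, fun x => ?_⟩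
  · change ‖A x‖ ^ 2 + ‖BiIsometry.sumInl R R (D₁ x)‖ ^ 2 = _
    rw [LinearIsometry.norm_map, hn, hD]
  · refine (hU (D₁ x)).trans ?_
    exact congrArg (fun y => WithLp.toLp 2 (y, (0 : R))) (hQ x)

end Dilation

/-! ### Realization of a contractive analytic function -/

namespace BiIsometry

variable {H : Type*} [NormedAddCommGroup H] [InnerProductSpace ℂ H]
  {G : Type*} [NormedAddCommGroup G] [InnerProductSpace ℂ G]

/-- The isometry `(h, r₀, r₁, …) ↦ (A h, D h, r₀, r₁, …)`. -/
def dilation (A : H →L[ℂ] H) (D : H →L[ℂ] G) (hD : ∀ x, ‖A x‖ ^ 2 + ‖D x‖ ^ 2 = ‖x‖ ^ 2) :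
    WithLp 2 (H × SeqSpace G) →ₗᵢ[ℂ] WithLp 2 (H × SeqSpace G) where
  toFun x := WithLp.toLp 2 (A x.fst, lp.single 2 0 (D x.fst) + SeqSpace.shift G x.snd)
  map_add' x y := by
    apply (WithLp.equiv 2 _).injective
    refine Prod.ext (by simp) ?_
    simp only [WithLp.add_fst, WithLp.add_snd, map_add, lp.single_add, WithLp.equiv_apply,
      WithLp.ofLp_add, Prod.snd_add]
    abel
  map_smul' c x := by
    apply (WithLp.equiv 2 _).injective
    refine Prod.ext (by simp) ?_
    simp [lp.single_smul, smul_add]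
  norm_map' x := by
    refine (sq_eq_sq₀ (norm_nonneg _) (norm_nonneg _)).1 ?_
    rw [WithLp.prod_norm_sq_eq_of_L2, WithLp.prod_norm_sq_eq_of_L2]
    change ‖A x.fst‖ ^ 2 + ‖lp.single 2 0 (D x.fst) + SeqSpace.shift G x.snd‖ ^ 2 = _
    rw [SeqSpace.norm_sq_single_add_shift, ← hD x.fst]
    ring

/-- The bi-isometry on `ℌ ⊕ ℓ²(𝔊)` built from an isometry, a commuting contraction and a defect
operator. -/
def ofDefect {V A : H →L[ℂ] H} (hV : ∀ x, ‖V x‖ = ‖x‖) (hAV : ∀ x, A (V x) = V (A x))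
    {U : G ≃ₗᵢ[ℂ] G} {D : H →L[ℂ] G} (hD : ∀ x, ‖A x‖ ^ 2 + ‖D x‖ ^ 2 = ‖x‖ ^ 2)
    (hUD : ∀ x, U (D x) = D (V x)) :
    BiIsometry (WithLp 2 (H × SeqSpace G)) where
  W₀ := isometryDirectSum ⟨(V : H →ₗ[ℂ] H), hV⟩ (SeqSpace.diag U.toLinearIsometry)
  W₁ := dilation A D hD
  comm x := by
    apply (WithLp.equiv 2 _).injective
    refine Prod.ext (hAV x.fst).symm ?_
    change SeqSpace.diag U.toLinearIsometry (lp.single 2 0 (D x.fst) + SeqSpace.shift G x.snd) =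
      lp.single 2 0 (D (V x.fst)) +
        SeqSpace.shift G (SeqSpace.diag U.toLinearIsometry x.snd)
    -- Commutation is decided in coordinate `0`, where it reads `U D h = D V h`; in higher
    -- coordinates both sides apply `U` to the shifted entry.
    ext n
    cases n with
    | zero => simp [hUD]
    | succ n => simp

theorem functionsUnitarilyEquivalent_ofDefect [CompleteSpace H] [CompleteSpace G]
    {V A : H →L[ℂ] H} (hV : ∀ x, ‖V x‖ = ‖x‖) (hAV : ∀ x, A (V x) = V (A x))
    {U : G ≃ₗᵢ[ℂ] G} {D : H →L[ℂ] G} (hD : ∀ x, ‖A x‖ ^ 2 + ‖D x‖ ^ 2 = ‖x‖ ^ 2)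
    (hUD : ∀ x, U (D x) = D (V x))
    (hpure : ∀ x, (∀ (k : ℕ), ∀ e ∈ defectSpace V, ⟪(V ^ k) e, x⟫_ℂ = 0) → x = 0) :
    FunctionsUnitarilyEquivalent (pairFunction V A) (ofDefect hV hAV hD hUD).charFunction := by
  set X := ofDefect hV hAV hD hUD with hX
  have hX₀ : ∀ x, X.W₀ x = WithLp.toLp 2 (V x.fst,
    SeqSpace.diag U.toLinearIsometry x.snd) := fun _ => rfl
  have hX₁ : ∀ x, X.W₁ x = WithLp.toLp 2 (A x.fst,
    lp.single 2 0 (D x.fst) + SeqSpace.shift G x.snd) := fun _ => rfl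
  clear_value X
  have hι : ∀ x, sumInl H (SeqSpace G) x = WithLp.toLp 2 (x, 0) := fun _ => rfl
  have hort : ∀ r : WithLp 2 (H × SeqSpace G),
      (∀ x, ⟪sumInl H (SeqSpace G) x, r⟫_ℂ = 0) ↔ r.fst = 0 := fun r => by
    simp only [hι, WithLp.prod_inner_apply, inner_zero_left, add_zero]
    exact ⟨fun h => inner_self_eq_zero.1 (h r.fst), fun h x => by
      change ⟪x, r.fst⟫_ℂ = 0
      rw [h, inner_zero_right]⟩
  refine functionsUnitarilyEquivalent_pairFunction X (sumInl H (SeqSpace G)) (fun x => ?_)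
    (fun r hr => ?_) (fun s hs => ?_) (fun x => ?_) hpure
  · rw [hX₀, hι, hι]
    exact congrArg (fun y => WithLp.toLp 2 (V x, y)) (map_zero _)
  · obtain ⟨s, hs⟩ := SeqSpace.diag_surjective U r.snd
    refine ⟨WithLp.toLp 2 (0, s), (hort _).2 rfl, ?_⟩
    rw [hX₀]
    apply (WithLp.equiv 2 _).injective
    exact Prod.ext ((map_zero _).trans ((hort r).1 hr).symm) hs
  · rw [hort] at *
    rw [hX₀]
    change V s.fst = 0
    rw [hs, map_zero]
  · rw [hort, hX₁, hι, hι]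
    change A x - A x = 0
    exact sub_self _

/-- Every contractive analytic function is the characteristic function of a bi-isometry. -/
theorem exists_charFunction_equiv {E : Type w} [NormedAddCommGroup E] [InnerProductSpace ℂ E]
    [CompleteSpace E] {Θ : ℂ → E →L[ℂ] E} (hΘ : IsContractiveAnalytic Θ) :
    ∃ (L : Type w) (_ : NormedAddCommGroup L) (_ : InnerProductSpace ℂ L) (_ : CompleteSpace L)
      (X : BiIsometry L), FunctionsUnitarilyEquivalent X.charFunction Θ := by
  obtain ⟨A, hA, hAV, hequiv⟩ := hΘ.exists_toeplitz
  have hV : ∀ x, ‖SeqSpace.shift E x‖ = ‖x‖ := SeqSpace.norm_shift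
  obtain ⟨G, _, _, _, U, D, hD, hUD⟩ := exists_defect_unitary hV hA hAV
  exact ⟨WithLp 2 (SeqSpace E × SeqSpace G), inferInstance, inferInstance, inferInstance, _,
    (functionsUnitarilyEquivalent_ofDefect hV hAV hD hUD
      fun x => SeqSpace.eq_zero_of_inner_shift_pow).symm.trans hequiv⟩

end BiIsometry

end

theorem corollary5p1
    {K : Type u} [NormedAddCommGroup K] [InnerProductSpace ℂ K] [CompleteSpace K]
    {K' : Type v} [NormedAddCommGroup K'] [InnerProductSpace ℂ K'] [CompleteSpace K']
    (W : BiIsometry K) (W' : BiIsometry K') :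
    -- (1) additivity, under the natural identification `J` of the sum of the two spaces `𝔈`
    -- with the space `𝔈` of the direct sum
    (∃ J : WithLp 2 (W.charSpace × W'.charSpace) ≃ₗᵢ[ℂ] (W.directSum W').charSpace,
      (∀ x, (((J x : (W.directSum W').shiftSpace)) : WithLp 2 (K × K')) =
        WithLp.toLp 2 (((x.fst : W.shiftSpace) : K), ((x.snd : W'.shiftSpace) : K'))) ∧
      ∀ z ∈ Metric.ball (0 : ℂ) 1, ∀ x,
        (W.directSum W').charFunction z (J x) =
          J (WithLp.toLp 2 (W.charFunction z x.fst, W'.charFunction z x.snd))) ∧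
    -- (2) unitary invariance
    (W.UnitarilyEquivalent W' →
      FunctionsUnitarilyEquivalent W.charFunction W'.charFunction) ∧
    -- (3) completeness of the invariant for pure bi-isometries
    (W.IsZeroPure → W'.IsZeroPure →
      FunctionsUnitarilyEquivalent W.charFunction W'.charFunction →
      W.UnitarilyEquivalent W') ∧
    -- (4) every contractive analytic function is realized
    (∀ (E : Type w) [NormedAddCommGroup E] [InnerProductSpace ℂ E] [CompleteSpace E]
      (Θ : ℂ → E →L[ℂ] E), IsContractiveAnalytic Θ →
      ∃ (L : Type w) (_ : NormedAddCommGroup L) (_ : InnerProductSpace ℂ L)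
        (_ : CompleteSpace L) (X : BiIsometry L),
        X.IsZeroPure ∧ FunctionsUnitarilyEquivalent X.charFunction Θ) := by
  refine ⟨?_, fun h => h.functionsUnitarilyEquivalent, fun hW hW' => hW.unitarilyEquivalent hW',
    fun E _ _ _ Θ hΘ => ?_⟩
  · obtain ⟨J, hJ⟩ := W.exists_charSpace_directSum_equiv W'
    exact ⟨J, hJ, fun z hz x => W.charFunction_directSum W' J hJ (by simpa using hz) x⟩
  · obtain ⟨L, _, _, _, X, hX⟩ := BiIsometry.exists_charFunction_equiv hΘ
    -- The bi-isometry `X` is not known to be pure, so its pure part is taken.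
    obtain ⟨N, hN, Y, hY, hYX⟩ := X.exists_isZeroPure_part
    exact ⟨N, inferInstance, inferInstance, hN, Y, hY, hYX.trans hX⟩
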